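/- **Setting.** Let $F$ be a totally real number field, $n=[F:\mathbb{Q}]$, and let $S_\infty$ be the set of its infinite places. Let $S\supseteq S_\infty$ and $T$ be disjoint finite sets of places of $F$, and let $V\subsetneq S$. Assume condition (C1): $V\not\supseteq S_\infty$; no prime of $S$ has the same residue characteristic as a prime of $T$; no two primes of $T$ have the same residue characteristic; and $T$ contains two distinct primes of degree one (absolute norm a rational prime), or one prime $\mathfrak q$ of degree one with $N\mathfrak q\ge n+2$. Put $S_f=S\setminus S_\infty$, and $\bar W=W\cup(S\setminus V)$ for $W\subseteq V$. Let $T'$ be the set of primes having the same residue characteristic as some prime of $T$. Let $\mathsf I_F$ be the group of fractional ideals, $\mathsf I_{(T)}$ the subgroup of those prime to $T'$, and $F_{(T)}\subseteq F^\times$ the group of elements prime to $T'$. Let $N^S=\prod'_{v\notin S}F_v^\times/O_v^\times$, let $i^S:F^\times\to N^S$ be the diagonal map, and let $\iota:\mathsf I_F\to N^S$ be the homomorphism with $\iota((x))=i^S(x)$. Let $\mathrm{sgn}(x)=\pm1$ be the product of the signs of $x$ at all infinite places. Let $E_+$ be the group of totally positive units and $C_F^+$ the narrow ideal class group. For a set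 $X$ let $C_k(X)$ be the free abelian group on $X^k$, with $d_k(x_1,\dots,x_k)=\sum_i(-1)^{i-1}(x_1,\dots,\widehat{x_i},\dots,x_k)$, and put $\mathcal C(X)=C_n(X)/\ker d_n$. For $W\subseteq S_\infty$ put $X_W=\prod_{v\in W}F_v^\times/\mathbb R_{>0}$; for $g\in X_W$ let $F_g$ be the set of elements of $F_{(T)}$ with image $g$ in $X_W$. Let $C_{k,W}=\bigoplus_{g\in X_W}C_k(F_g)\llbracket g\rrbracket$, on which $x\in F_{(T)}$ acts by $[x](\Lambda\llbracket g\rrbracket)=\mathrm{sgn}(x)(x\Lambda)\llbracket xg\rrbracket$, and put $\mathscr K_W=C_{n,W}/\ker d_n$. For $W\subseteq S_f$ let $\mathscr A_W\subset\mathbb Z[\mathsf I_F]$ be the $\mathbb Z[\mathsf I_{(T)}]$-submodule generated by $\prod_{\mathfrak p\in W}(1-[\mathfrak p])\prod_{\mathfrak p\in T}(1-N(\mathfrak p)[\mathfrak p])$. For $W\subseteq V$ let $\mathscr M_W=\mathscr K_{\bar W\cap S_\infty}\otimes_{\mathbb Z}\mathscr A_{\bar W\cap S_f}$ with the diagonal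 action of $F_{(T)}$ ($x$ acting on $\mathscr A$ as multiplication by $[(x)]$), and let $$B(W)=\bigl(\mathscr M_W\otimes\mathbb Z[N^S]\otimes\mathbb Z[F^\times]\bigr)/\mathscr N,$$ where $\mathscr N$ is spanned by the elements $x^{-1}a\otimes i^S(x)b\otimes c-a\otimes b\otimes xc$ with $x\in F_{(T)}$. The group $F^\times$ acts on $B(W)$ by $x(a\otimes b\otimes c)=a\otimes b\otimes xc$. For $W'\subseteq W\subseteq V$ let $r^W_{W'}:B(W)\to B(W')$ be induced by the projection $X_{\bar W\cap S_\infty}\to X_{\bar W'\cap S_\infty}$ and the inclusion $\mathscr A_{\bar W\cap S_f}\subseteq\mathscr A_{\bar W'\cap S_f}$. For a $\mathbb Z[F^\times]$-module $M$ put $IM=\ker(M\to M\otimes_{\mathbb Z[F^\times]}\mathbb Z)$. Let $I_{E_+}\subset\mathbb{Z}[E_+]$ be the augmentation ideal. Write $H_{n-1}(E_+,\mathbb Z)=Z/U$ with $U=I_{E_+}\mathcal C(F^\times)$ and $Z=\{D\in\mathcal C(F^\times): d_nD\in I_{E_+}C_{n-1}(F^\times)\}$ (for $n=1$, $Z=\mathcal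 C(F^\times)$). Let $\eta$ be a generator of $H_{n-1}(E_+,\mathbb Z)$, and let $g_0\in X_{S_\infty}$ be the class of $1$. For $C\in C_F^+$ choose $\mathfrak a\in C\cap\mathsf I_{(T)}$ and $D\in\mathcal C(F_{g_0})\cap Z$ with class $\eta$, and let $\vartheta_C\in B(V)/IB(V)$ be the class of $$\bigl(D\llbracket g_0\rrbracket\otimes\mathfrak a^{-1}\delta_{S,T}\bigr)\otimes\iota(\mathfrak a)\otimes 1,\qquad \delta_{S,T}=\prod_{\mathfrak p\in S_f}(1-[\mathfrak p])\prod_{\mathfrak p\in T}(1-N(\mathfrak p)[\mathfrak p]).$$ Put $\vartheta=\sum_{C\in C_F^+}\vartheta_C\in B(V)/IB(V)$. **Proposition.** For every such $\eta$ and every such choice of the $\mathfrak a$ and $D$, and for every lift $a\in B(V)$ of $\vartheta$, one has $r^V_{V\setminus\{v\}}(a)\in I\,B(V\setminus\{v\})$ for all $v\in V$. -/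

import Mathlib

open NumberField IsDedekindDomain
open scoped nonZeroDivisors TensorProduct RestrictedProduct

namespace Shintani

attribute [local instance 10] AddCommGroup.toIntModule

noncomputable section

/-! ### Places, signs, ideals -/

section Basic

variable (F : Type*) [Field F] [NumberField F]

/-- The places of the number field `F`: infinite places and nonzero primes of `𝓞 F`. -/
abbrev Place : Type _ := InfinitePlace F ⊕ HeightOneSpectrum (𝓞 F)

instance instDecidableEqPlace : DecidableEq (Place F) := Classical.decEq _

/-- The group `I_F` of (nonzero) fractional ideals of `F`. -/
abbrev FracIdeals : Type _ := (FractionalIdeal (𝓞 F)⁰ F)ˣ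

/-- The principal fractional ideal `(x)`. -/
abbrev principal : Fˣ →* FracIdeals F := toPrincipalIdeal (𝓞 F) F

variable {F}

/-- The residue characteristic of a finite place. -/
def residueChar (p : HeightOneSpectrum (𝓞 F)) : ℕ := ringChar (𝓞 F ⧸ p.asIdeal)

/-- The absolute norm `N(p)` of a finite place. -/
def norm (p : HeightOneSpectrum (𝓞 F)) : ℕ := Ideal.absNorm p.asIdeal

/-- A prime regarded as an element of the group of fractional ideals. -/
def primeIdeal (p : HeightOneSpectrum (𝓞 F)) : FracIdeals F :=
  Units.mk0 (p.asIdeal : FractionalIdeal (𝓞 F)⁰ F)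
    (FractionalIdeal.coeIdeal_ne_zero.mpr p.ne_bot)

/-- The condition (C1) on `(S, T, V)`. -/
structure ConditionC1 (S T V : Finset (Place F)) : Prop where
  /-- `V` does not contain all infinite places. -/
  not_infinite_subset : ∃ w : InfinitePlace F, Sum.inl w ∉ V
  /-- No prime of `S` has the same residue characteristic as a prime of `T`. -/
  residueChar_S_T : ∀ p ∈ S.toRight, ∀ q ∈ T.toRight, residueChar p ≠ residueChar q
  /-- No two primes of `T` have the same residue characteristic. -/
  residueChar_T : ∀ p ∈ T.toRight, ∀ q ∈ T.toRight, p ≠ q → residueChar p ≠ residueChar q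
  /-- `T` contains two primes of degree one, or one such prime of norm at least `n + 2`. -/
  degree_one : (∃ p ∈ T.toRight, ∃ q ∈ T.toRight, p ≠ q ∧ (norm p).Prime ∧ (norm q).Prime) ∨
    ∃ p ∈ T.toRight, (norm p).Prime ∧ Module.finrank ℚ F + 2 ≤ norm p

/-- `I_(T)`: the fractional ideals prime to `T'`, where `T'` is the set of all primes that have
the same residue characteristic as some prime in `T`. -/
def idealsPrimeTo (T : Finset (Place F)) : Subgroup (FracIdeals F) where
  carrier := {I | ∀ p : HeightOneSpectrum (𝓞 F),
    (∃ q ∈ T.toRight, residueChar p = residueChar q) →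
      FractionalIdeal.count F p (I : FractionalIdeal (𝓞 F)⁰ F) = 0}
  one_mem' := fun p _ => by simpa using FractionalIdeal.count_one F p
  mul_mem' := fun {a b} ha hb p hp => by
    rw [Units.val_mul, FractionalIdeal.count_mul F p a.ne_zero b.ne_zero, ha p hp, hb p hp,
      add_zero]
  inv_mem' := fun {a} ha p hp => by
    rw [Units.val_inv_eq_inv_val, FractionalIdeal.count_inv, ha p hp, neg_zero]

/-- `F_(T)`: the elements of `Fˣ` prime to `T'`. -/
def unitsPrimeTo (T : Finset (Place F)) : Subgroup Fˣ := (idealsPrimeTo T).comap (principal F)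

lemma primeIdeal_mem_idealsPrimeTo {T : Finset (Place F)} {p : HeightOneSpectrum (𝓞 F)}
    (hp : ∀ q ∈ T.toRight, residueChar p ≠ residueChar q) : primeIdeal p ∈ idealsPrimeTo T := by
  rintro q ⟨r, hr, hqr⟩
  refine FractionalIdeal.count_maximal_coprime F q ?_
  rintro rfl
  exact hp r hr hqr

variable [IsTotallyReal F]

/-- The sign `±1` of `x ∈ Fˣ` at an infinite (real) place; it identifies `F_wˣ / ℝ_{>0}` with
`{±1} = ℤˣ`. -/
def signAt (w : InfinitePlace F) : Fˣ →* ℤˣ :=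
  Units.map (((SignType.castHom (α := ℤ)).comp (signHom (α := ℝ))).toMonoidHom.comp
    (InfinitePlace.embedding_of_isReal (IsTotallyReal.isReal w)).toMonoidHom)

/-- `sgn x`, the product of the signs of `x` at all infinite places. -/
def sgn : Fˣ →* ℤˣ := ∏ w : InfinitePlace F, signAt w

/-- `X_W = ∏_{w ∈ W} F_wˣ / ℝ_{>0}`. -/
abbrev SignGroup (W : Finset (InfinitePlace F)) : Type _ := W → ℤˣ

/-- The diagonal map `Fˣ → X_W`. -/
def signs (W : Finset (InfinitePlace F)) : Fˣ →* SignGroup W :=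
  MonoidHom.pi fun w => signAt w.1

/-- `F_g` for `g ∈ X_W`: the elements of `F_(T)` with image `g` in `X_W`. -/
abbrev SignClass (T : Finset (Place F)) {W : Finset (InfinitePlace F)} (g : SignGroup W) :
    Type _ :=
  {x : unitsPrimeTo T // signs W x.1 = g}

variable (F) in
/-- The totally positive elements of `Fˣ`. -/
def totallyPositive : Subgroup Fˣ := (signs (Finset.univ : Finset (InfinitePlace F))).ker

variable (F) in
/-- `E_+`: the totally positive units of `𝓞 F`, as a subgroup of `Fˣ`. -/
def posUnits : Subgroup Fˣ :=
  (Units.map (algebraMap (𝓞 F) F).toMonoidHom).range ⊓ totallyPositive F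

variable (F) in
/-- The narrow class group `C_F^+`. -/
abbrev NarrowClassGroup : Type _ := FracIdeals F ⧸ (totallyPositive F).map (principal F)

variable (F) in
instance instFiniteNarrowClassGroup : Finite (NarrowClassGroup F) := by
  have h1 : (toPrincipalIdeal (𝓞 F) F).range.FiniteIndex := by
    have : Finite (FracIdeals F ⧸ (toPrincipalIdeal (𝓞 F) F).range) :=
      Finite.of_equiv _ (ClassGroup.equiv (R := 𝓞 F) F).toEquiv
    exact Subgroup.finiteIndex_of_finite_quotient
  have h2 : (totallyPositive F).FiniteIndex := Subgroup.finiteIndex_ker _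
  have h3 : ((totallyPositive F).map (principal F)).FiniteIndex := by
    refine ⟨?_⟩
    rw [Subgroup.index_map]
    refine mul_ne_zero ?_ h1.index_ne_zero
    exact (Subgroup.finiteIndex_of_le (H := totallyPositive F) le_sup_left).index_ne_zero
  exact Subgroup.finite_quotient_of_finiteIndex

end Basic

/-! ### The group `N^S` and the homomorphisms `i^S`, `ι` -/

section NS

variable {F : Type*} [Field F] [NumberField F]

/-- `N_v = F_vˣ / O_vˣ` for a finite place `v`. -/
abbrev LocalQuotient (v : HeightOneSpectrum (𝓞 F)) : Type _ :=
  (v.adicCompletion F)ˣ ⧸ (v.adicCompletionIntegers F).toSubring.toSubmonoid.units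

/-- `N^S`: the restricted product of the groups `F_vˣ / O_vˣ` over the (finite) places `v ∉ S`. -/
abbrev NS (S : Finset (Place F)) : Type _ :=
  Πʳ v : {v : HeightOneSpectrum (𝓞 F) // Sum.inr v ∉ S},
    [LocalQuotient v.1, (⊥ : Subgroup (LocalQuotient v.1))]

/-- The image of `x ∈ Fˣ` in `F_vˣ / O_vˣ`. -/
def toLocal (v : HeightOneSpectrum (𝓞 F)) : Fˣ →* LocalQuotient v :=
  (QuotientGroup.mk' _).comp (Units.map (algebraMap F (v.adicCompletion F)).toMonoidHom)

/-- An element of `Fˣ` of valuation one at `v`. -/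
def uniformizer (v : HeightOneSpectrum (𝓞 F)) : Fˣ :=
  Units.mk0 _ (HeightOneSpectrum.valuation_uniformizer_ne_zero F v)

lemma toLocal_eq_one_iff (v : HeightOneSpectrum (𝓞 F)) (x : Fˣ) :
    toLocal v x = 1 ↔ v.valuation F (x : F) = 1 := by
  rw [toLocal, MonoidHom.comp_apply, QuotientGroup.mk'_apply, QuotientGroup.eq_one_iff,
    HeightOneSpectrum.adicCompletionIntegers.mem_units_iff_valued_eq_one]
  exact Eq.congr_left (HeightOneSpectrum.valuedAdicCompletion_eq_valuation' v (x : F))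

lemma valuation_eq_exp_neg_count (v : HeightOneSpectrum (𝓞 F)) (x : Fˣ) :
    v.valuation F (x : F) = WithZero.exp
      (-FractionalIdeal.count F v (principal F x : FractionalIdeal (𝓞 F)⁰ F)) := by
  obtain ⟨x, x', h1, h2⟩ := x
  obtain ⟨r, s, hs, rfl⟩ := IsFractionRing.div_surjective (A := 𝓞 F) x
  have hs0 : s ≠ 0 := nonZeroDivisors.ne_zero hs
  have hx0 : algebraMap (𝓞 F) F r / algebraMap (𝓞 F) F s ≠ 0 := left_ne_zero_of_mul_eq_one h1
  have hr0 : r ≠ 0 := by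
    rintro rfl
    simp at hx0
  rw [coe_toPrincipalIdeal]
  change v.valuation F (algebraMap (𝓞 F) F r / algebraMap (𝓞 F) F s) = _
  have hI : FractionalIdeal.spanSingleton (𝓞 F)⁰ (algebraMap (𝓞 F) F r / algebraMap (𝓞 F) F s) ≠ 0 :=
    FractionalIdeal.spanSingleton_ne_zero_iff.mpr hx0
  have key := FractionalIdeal.count_well_defined F v hI (a := s) (J := Ideal.span {r}) (by
    rw [FractionalIdeal.coeIdeal_span_singleton, FractionalIdeal.spanSingleton_mul_spanSingleton,
      div_eq_mul_inv, mul_comm])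
  rw [map_div₀, HeightOneSpectrum.valuation_of_algebraMap,
    HeightOneSpectrum.valuation_of_algebraMap, HeightOneSpectrum.intValuation_if_neg v hr0,
    HeightOneSpectrum.intValuation_if_neg v hs0, ← WithZero.exp_sub]
  refine congrArg WithZero.exp ?_
  refine Eq.trans ?_ (congrArg Neg.neg key.symm)
  ring

/-- `ι : I_F → N^S`; its component at `v ∉ S` sends `𝔞` to the class of the elements of `F_vˣ`
that generate `𝔞 O_v`. -/
def iota (S : Finset (Place F)) : FracIdeals F →* NS S where
  toFun I := RestrictedProduct.mk
    (fun v => toLocal v.1 (uniformizer v.1) ^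
      FractionalIdeal.count F v.1 (I : FractionalIdeal (𝓞 F)⁰ F))
    (by
      have h := FractionalIdeal.finite_factors (K := F) (I : FractionalIdeal (𝓞 F)⁰ F)
      refine (Subtype.val_injective.tendsto_cofinite.eventually h).mono fun v hv => ?_
      rw [hv, zpow_zero]
      exact one_mem _)
  map_one' := RestrictedProduct.ext _ _ fun v => by
    change toLocal v.1 (uniformizer v.1) ^ FractionalIdeal.count F v.1 1 = 1
    rw [FractionalIdeal.count_one, zpow_zero]
  map_mul' I J := RestrictedProduct.ext _ _ fun v => by
    change toLocal v.1 (uniformizer v.1) ^ FractionalIdeal.count F v.1 _ =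
      toLocal v.1 (uniformizer v.1) ^ FractionalIdeal.count F v.1 _ *
        toLocal v.1 (uniformizer v.1) ^ FractionalIdeal.count F v.1 _
    rw [Units.val_mul, FractionalIdeal.count_mul F v.1 I.ne_zero J.ne_zero, zpow_add]

/-- `i^S : Fˣ → N^S`, the diagonal map. -/
def iS (S : Finset (Place F)) : Fˣ →* NS S where
  toFun x := RestrictedProduct.mk (fun v => toLocal v.1 x) (by
      have h := FractionalIdeal.finite_factors (K := F)
        (principal F x : FractionalIdeal (𝓞 F)⁰ F)
      refine (Subtype.val_injective.tendsto_cofinite.eventually h).mono fun v hv => ?_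
      refine Subgroup.mem_bot.mpr ?_
      rw [toLocal_eq_one_iff, valuation_eq_exp_neg_count, hv, neg_zero, WithZero.exp_zero])
  map_one' := RestrictedProduct.ext _ _ fun v => map_one (toLocal v.1)
  map_mul' x y := RestrictedProduct.ext _ _ fun v => map_mul (toLocal v.1) x y

/-- `ι` extends `i^S`. -/
lemma iota_principal (S : Finset (Place F)) (x : Fˣ) : iota S (principal F x) = iS S x := by
  refine RestrictedProduct.ext _ _ fun v => ?_
  change toLocal v.1 (uniformizer v.1) ^ FractionalIdeal.count F v.1 _ = toLocal v.1 x
  rw [← map_zpow (toLocal v.1), ← div_eq_one, ← map_div (toLocal v.1), toLocal_eq_one_iff, Units.val_div_eq_div_val, map_div₀,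
    valuation_eq_exp_neg_count v.1 x, Units.val_zpow_eq_zpow_val, map_zpow₀]
  have h : v.1.valuation F (uniformizer v.1 : F) = WithZero.exp (-1 : ℤ) :=
    Classical.choose_spec (v.1.valuation_exists_uniformizer F)
  rw [h, ← WithZero.exp_zsmul, smul_eq_mul, mul_neg_one, div_self WithZero.exp_ne_zero]

end NS

/-! ### Induced modules -/

section Induced

variable {R H N G M M' : Type*} [CommRing R] [Group H] [Monoid N] [CommGroup G]
  [AddCommGroup M] [Module R M] [AddCommGroup M'] [Module R M']

/-- The submodule `𝒩` of `M ⊗ R[N] ⊗ R[G]` generated by the elements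
`x⁻¹a ⊗ i(x)b ⊗ c - a ⊗ b ⊗ j(x)c` with `x ∈ H`. -/
def inducedRel (ρ : Representation R H M) (i : H →* N) (j : H →* G) :
    Submodule R ((M ⊗[R] MonoidAlgebra R N) ⊗[R] MonoidAlgebra R G) :=
  Submodule.span R {z | ∃ (x : H) (a : M) (b : MonoidAlgebra R N) (c : MonoidAlgebra R G),
    z = (ρ x⁻¹ a ⊗ₜ[R] (MonoidAlgebra.single (i x) (1 : R) * b)) ⊗ₜ[R] c -
      (a ⊗ₜ[R] b) ⊗ₜ[R] (MonoidAlgebra.single (j x) (1 : R) * c)}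

/-- `(M ⊗ R[N] ⊗ R[G]) / 𝒩`. -/
def Induced (ρ : Representation R H M) (i : H →* N) (j : H →* G) : Type _ :=
  ((M ⊗[R] MonoidAlgebra R N) ⊗[R] MonoidAlgebra R G) ⧸ inducedRel ρ i j

namespace Induced

instance instAddCommGroup (ρ : Representation R H M) (i : H →* N) (j : H →* G) :
    AddCommGroup (Induced ρ i j) :=
  inferInstanceAs (AddCommGroup (_ ⧸ inducedRel ρ i j))

instance instModule (ρ : Representation R H M) (i : H →* N) (j : H →* G) :
    Module R (Induced ρ i j) :=
  inferInstanceAs (Module R (_ ⧸ inducedRel ρ i j))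

/-- The projection `M ⊗ R[N] ⊗ R[G] → (M ⊗ R[N] ⊗ R[G]) / 𝒩`. -/
def mk (ρ : Representation R H M) (i : H →* N) (j : H →* G) :
    (M ⊗[R] MonoidAlgebra R N) ⊗[R] MonoidAlgebra R G →ₗ[R] Induced ρ i j :=
  Submodule.mkQ (inducedRel ρ i j)

lemma mk_surjective (ρ : Representation R H M) (i : H →* N) (j : H →* G) :
    Function.Surjective (mk ρ i j) :=
  Submodule.mkQ_surjective _

/-- The action `x(a ⊗ b ⊗ c) = a ⊗ b ⊗ xc` of `G` on `M ⊗ R[N] ⊗ R[G]`. -/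
def preRep (R M N G : Type*) [CommRing R] [Monoid N] [CommGroup G] [AddCommGroup M] [Module R M] :
    Representation R G ((M ⊗[R] MonoidAlgebra R N) ⊗[R] MonoidAlgebra R G) where
  toFun x := TensorProduct.map LinearMap.id
    (LinearMap.mulLeft R (MonoidAlgebra.single x (1 : R)))
  map_one' := by
    rw [← MonoidAlgebra.one_def, LinearMap.mulLeft_one, TensorProduct.map_id]
    rfl
  map_mul' x y := by
    rw [← TensorProduct.map_mul, Module.End.mul_eq_comp, Module.End.mul_eq_comp,
      ← LinearMap.mulLeft_mul, MonoidAlgebra.single_mul_single, mul_one, LinearMap.id_comp]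

/-- The action `x(a ⊗ b ⊗ c) = a ⊗ b ⊗ xc` of `G` on `(M ⊗ R[N] ⊗ R[G]) / 𝒩`. -/
def rep (ρ : Representation R H M) (i : H →* N) (j : H →* G) :
    Representation R G (Induced ρ i j) :=
  (preRep R M N G).quotient (inducedRel ρ i j) fun x => by
    refine Submodule.span_le.mpr ?_
    rintro _ ⟨y, a, b, c, rfl⟩
    refine Submodule.subset_span ⟨y, a, b, MonoidAlgebra.single x (1 : R) * c, ?_⟩
    rw [map_sub, mul_left_comm]
    rfl

/-- The map `a ⊗ b ⊗ c ↦ f(a) ⊗ b ⊗ c` induced by an equivariant map `f : M → M'`. -/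
def map {ρ : Representation R H M} {ρ' : Representation R H M'} (i : H →* N) (j : H →* G)
    (f : M →ₗ[R] M') (hf : ∀ x a, f (ρ x a) = ρ' x (f a)) : Induced ρ i j →ₗ[R] Induced ρ' i j :=
  Submodule.mapQ _ _ (TensorProduct.map (TensorProduct.map f LinearMap.id) LinearMap.id) (by
    refine Submodule.span_le.mpr ?_
    rintro _ ⟨y, a, b, c, rfl⟩
    refine Submodule.subset_span ⟨y, f a, b, c, ?_⟩
    rw [map_sub, ← hf]
    rfl)

/-- The induced map is `G`-equivariant. -/
lemma map_rep {ρ : Representation R H M} {ρ' : Representation R H M'} (i : H →* N) (j : H →* G)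
    (f : M →ₗ[R] M') (hf : ∀ x a, f (ρ x a) = ρ' x (f a)) (x : G) (a : Induced ρ i j) :
    map i j f hf (rep ρ i j x a) = rep ρ' i j x (map i j f hf a) := by
  obtain ⟨c, rfl⟩ := mk_surjective ρ i j a
  refine congrArg (mk ρ' i j) ?_
  induction c using TensorProduct.induction_on with
  | zero => simp only [map_zero]
  | add a b ha hb => simp only [map_add, ha, hb]
  | tmul a c => rfl

end Induced

lemma tprod_map_equivariant {P P' : Type*} [AddCommGroup P] [Module R P] [AddCommGroup P']
    [Module R P'] {ρ : Representation R H M} {ρ' : Representation R H M'}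
    {σ : Representation R H P} {σ' : Representation R H P'} {f : M →ₗ[R] M'} {g : P →ₗ[R] P'}
    (hf : ∀ x a, f (ρ x a) = ρ' x (f a)) (hg : ∀ x a, g (σ x a) = σ' x (g a)) (x : H)
    (a : M ⊗[R] P) :
    TensorProduct.map f g (ρ.tprod σ x a) = ρ'.tprod σ' x (TensorProduct.map f g a) := by
  induction a using TensorProduct.induction_on with
  | zero => simp only [map_zero]
  | add a b ha hb => simp only [map_add, ha, hb]
  | tmul a c =>
    simp only [Representation.tprod_apply, TensorProduct.map_tmul, hf, hg]

end Induced

/-! ### Chains -/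

section Chains

/-- The permutation representation on the free abelian group over a set with a group action. -/
def permRep (G Y : Type*) [Group G] [MulAction G Y] : Representation ℤ G (Y →₀ ℤ) where
  toFun g := Finsupp.lmapDomain ℤ ℤ (g • ·)
  map_one' := by ext; simp
  map_mul' g h := by ext; simp [mul_smul]

/-- `C_k(X)`: the free abelian group on `X^k`. -/
abbrev Chain (X : Type*) (k : ℕ) : Type _ := (Fin k → X) →₀ ℤ

/-- The differential `d_{k+1} : C_{k+1}(X) → C_k(X)`. -/
def chainD (X : Type*) (k : ℕ) : Chain X (k + 1) →ₗ[ℤ] Chain X k :=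
  Finsupp.linearCombination ℤ fun t =>
    ∑ i : Fin (k + 1), (-1 : ℤ) ^ (i : ℕ) • Finsupp.single (i.removeNth t) (1 : ℤ)

/-- `C_{m+1}(X) / ker d_{m+1}`. -/
abbrev ChainMod (X : Type*) (m : ℕ) : Type _ := Chain X (m + 1) ⧸ LinearMap.ker (chainD X m)

/-- The map `C_k(X) → C_k(Y)` induced by a map `X → Y`. -/
def chainMap {X Y : Type*} (f : X → Y) (k : ℕ) : Chain X k →ₗ[ℤ] Chain Y k :=
  Finsupp.lmapDomain ℤ ℤ (f ∘ ·)

lemma chainD_chainMap {X Y : Type*} (f : X → Y) (k : ℕ) (c : Chain X (k + 1)) :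
    chainD Y k (chainMap f (k + 1) c) = chainMap f k (chainD X k c) := by
  induction c using Finsupp.induction_linear with
  | zero => simp only [map_zero]
  | add a b ha hb => simp only [map_add, ha, hb]
  | single t r =>
    simp only [chainMap, chainD, Finsupp.lmapDomain_apply, Finsupp.mapDomain_single,
      Finsupp.linearCombination_single, Finsupp.mapDomain_smul,
      Finsupp.mapDomain_finsetSum]
    rfl

/-- The map `C_{m+1}(X) / ker d_{m+1} → C_{m+1}(Y) / ker d_{m+1}` induced by a map `X → Y`. -/
def chainModMap {X Y : Type*} (f : X → Y) (m : ℕ) : ChainMod X m →ₗ[ℤ] ChainMod Y m :=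
  Submodule.mapQ _ _ (chainMap f (m + 1)) fun c hc => by
    rw [Submodule.mem_comap, LinearMap.mem_ker, chainD_chainMap, LinearMap.mem_ker.mp hc, map_zero]

variable {F : Type*} [Field F] [NumberField F]

variable (F) in
/-- `𝒞(X) = C_n(X) / ker d_n` with `n = [F : ℚ]` (so that `n = (n - 1) + 1`). -/
abbrev ConeMod (X : Type*) : Type _ := ChainMod X (Module.finrank ℚ F - 1)

/-- `Z_A`, for a subgroup `A` of `Fˣ`: the classes `D ∈ 𝒞(Fˣ)` such that `d_n D` lies in
`I_A C_{n-1}(Fˣ)`. For `n = 1` the group `C_{n-1} = C_0 = ℤ` is not a term of the resolution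
`⋯ → C_2(Fˣ) → C_1(Fˣ) → ℤ`, hence there is no condition: every element is a `0`-cycle. -/
def cyclesOf (A : Subgroup Fˣ) : Submodule ℤ (ConeMod F Fˣ) where
  carrier := {D | Module.finrank ℚ F ≠ 1 →
    (LinearMap.ker (chainD Fˣ (Module.finrank ℚ F - 1))).liftQ
      (chainD Fˣ (Module.finrank ℚ F - 1)) le_rfl D ∈
        Representation.Coinvariants.ker (permRep A (Fin (Module.finrank ℚ F - 1) → Fˣ))}
  zero_mem' := fun _ => by rw [map_zero]; exact Submodule.zero_mem _
  add_mem' := fun ha hb h => by rw [map_add]; exact Submodule.add_mem _ (ha h) (hb h)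
  smul_mem' := fun c a ha h => by rw [map_smul]; exact Submodule.smul_mem _ c (ha h)

/-- `U_A = I_A 𝒞(Fˣ)`, for a subgroup `A` of `Fˣ`. -/
def boundariesOf (A : Subgroup Fˣ) : Submodule ℤ (ConeMod F Fˣ) :=
  (Representation.Coinvariants.ker
    (permRep A (Fin (Module.finrank ℚ F - 1 + 1) → Fˣ))).map (Submodule.mkQ _)

/-- `H_{n-1}(A, ℤ) = Z_A / U_A`, the homology of `A` in degree `n - 1` computed by the free
resolution `⋯ → C_2(Fˣ) → C_1(Fˣ) → ℤ → 0`. -/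
abbrev HomologyOf (A : Subgroup Fˣ) : Type _ :=
  cyclesOf A ⧸ (boundariesOf A).submoduleOf (cyclesOf A)

/-- `Y(c)`: the elements of `Z_A` with homology class `c`. -/
def cyclesInClass {A : Subgroup Fˣ} (c : HomologyOf A) : Set (ConeMod F Fˣ) :=
  {D | ∃ h : D ∈ cyclesOf A, Submodule.Quotient.mk ⟨D, h⟩ = c}

end Chains

/-! ### The modules `𝒦_W`, `𝒜_W`, `ℳ_W` -/

section Modules

variable {F : Type*} [Field F] [NumberField F] [IsTotallyReal F]

/-- The natural basis of `C_{k,W} = ⨁_{g ∈ X_W} C_k(F_g)`: the pairs `(g, x)` with `g ∈ X_W` and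
`x ∈ (F_g)^k`; such a pair stands for `(x_1, …, x_k)⟦g⟧`. -/
abbrev SignedTuple (T : Finset (Place F)) (k : ℕ) (W : Finset (InfinitePlace F)) : Type _ :=
  {p : SignGroup W × (Fin k → unitsPrimeTo T) // ∀ i, signs W (p.2 i).1 = p.1}

/-- The action `x • (x_1, …, x_k)⟦g⟧ = (x x_1, …, x x_k)⟦x g⟧` of `F_(T)` on the basis. -/
instance instMulActionSignedTuple (T : Finset (Place F)) (k : ℕ) (W : Finset (InfinitePlace F)) :
    MulAction (unitsPrimeTo T) (SignedTuple T k W) where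
  smul x p := ⟨(signs W x.1 * p.1.1, fun i => x * p.1.2 i), fun i => by
    simp only [Subgroup.coe_mul, map_mul, p.2 i]⟩
  one_smul p := Subtype.ext (Prod.ext (by
    change signs W 1 * p.1.1 = p.1.1
    rw [map_one, one_mul]) (funext fun i => one_mul _))
  mul_smul x y p := Subtype.ext (Prod.ext (by
    change signs W (x.1 * y.1) * p.1.1 = signs W x.1 * (signs W y.1 * p.1.1)
    rw [map_mul, mul_assoc]) (funext fun i => mul_assoc _ _ _))

/-- `C_{k,W}`. -/
abbrev SignedChain (T : Finset (Place F)) (k : ℕ) (W : Finset (InfinitePlace F)) : Type _ :=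
  SignedTuple T k W →₀ ℤ

/-- The action of `F_(T)` on `C_{k,W}`: `[x](Λ⟦g⟧) = sgn(x) (xΛ)⟦xg⟧`. -/
def signedRep (T : Finset (Place F)) (k : ℕ) (W : Finset (InfinitePlace F)) :
    Representation ℤ (unitsPrimeTo T) (SignedChain T k W) where
  toFun x := ((sgn x.1 : ℤˣ) : ℤ) • permRep (unitsPrimeTo T) (SignedTuple T k W) x
  map_one' := by simp
  map_mul' x y := by
    rw [Subgroup.coe_mul, map_mul, map_mul, Units.val_mul, smul_mul_smul_comm]

lemma signedRep_apply (T : Finset (Place F)) (k : ℕ) (W : Finset (InfinitePlace F))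
    (x : unitsPrimeTo T) (c : SignedChain T k W) :
    signedRep T k W x c = ((sgn x.1 : ℤˣ) : ℤ) • Finsupp.mapDomain (x • ·) c :=
  rfl

/-- Omission of the `i`-th entry of a tuple. -/
def SignedTuple.face {T : Finset (Place F)} {k : ℕ} {W : Finset (InfinitePlace F)}
    (i : Fin (k + 1)) (p : SignedTuple T (k + 1) W) : SignedTuple T k W :=
  ⟨(p.1.1, i.removeNth p.1.2), fun j => p.2 (i.succAbove j)⟩

/-- The differential `d_{k+1} : C_{k+1,W} → C_{k,W}`. -/
def signedD (T : Finset (Place F)) (k : ℕ) (W : Finset (InfinitePlace F)) :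
    SignedChain T (k + 1) W →ₗ[ℤ] SignedChain T k W :=
  Finsupp.linearCombination ℤ fun p =>
    ∑ i : Fin (k + 1), (-1 : ℤ) ^ (i : ℕ) • Finsupp.single (SignedTuple.face i p) (1 : ℤ)

lemma signedD_signedRep (T : Finset (Place F)) (k : ℕ) (W : Finset (InfinitePlace F))
    (x : unitsPrimeTo T) (c : SignedChain T (k + 1) W) :
    signedD T k W (signedRep T (k + 1) W x c) = signedRep T k W x (signedD T k W c) := by
  induction c using Finsupp.induction_linear with
  | zero => simp only [map_zero]
  | add a b ha hb => simp only [map_add, ha, hb]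
  | single t r =>
    rw [signedRep_apply, signedRep_apply, map_smul]
    simp only [signedD, Finsupp.mapDomain_single,
      Finsupp.linearCombination_single, Finsupp.mapDomain_smul, Finsupp.mapDomain_finsetSum]
    rfl

/-- `𝒦_W = C_{n,W} / ker d_n`, where `n = [F : ℚ]`. -/
def KMod (T : Finset (Place F)) (W : Finset (InfinitePlace F)) : Type _ :=
  SignedChain T (Module.finrank ℚ F - 1 + 1) W ⧸
    LinearMap.ker (signedD T (Module.finrank ℚ F - 1) W)

instance KMod.instAddCommGroup (T : Finset (Place F)) (W : Finset (InfinitePlace F)) :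
    AddCommGroup (KMod T W) :=
  inferInstanceAs (AddCommGroup (_ ⧸ LinearMap.ker (signedD T (Module.finrank ℚ F - 1) W)))

instance KMod.instModule (T : Finset (Place F)) (W : Finset (InfinitePlace F)) :
    Module ℤ (KMod T W) :=
  inferInstanceAs (Module ℤ (_ ⧸ LinearMap.ker (signedD T (Module.finrank ℚ F - 1) W)))

/-- The projection `C_{n,W} → 𝒦_W`. -/
def KMod.mk (T : Finset (Place F)) (W : Finset (InfinitePlace F)) :
    SignedChain T (Module.finrank ℚ F - 1 + 1) W →ₗ[ℤ] KMod T W :=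
  Submodule.mkQ (LinearMap.ker (signedD T (Module.finrank ℚ F - 1) W))

lemma KMod.mk_surjective (T : Finset (Place F)) (W : Finset (InfinitePlace F)) :
    Function.Surjective (KMod.mk T W) :=
  Submodule.mkQ_surjective _

/-- The action of `F_(T)` on `𝒦_W`. -/
def repK (T : Finset (Place F)) (W : Finset (InfinitePlace F)) :
    Representation ℤ (unitsPrimeTo T) (KMod T W) :=
  (signedRep T _ W).quotient _ fun x c hc => by
    rw [Submodule.mem_comap, LinearMap.mem_ker, signedD_signedRep, LinearMap.mem_ker.mp hc,
      map_zero]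

/-- The map of bases `(g, x) ↦ (g|_{W'}, x)` for `W' ⊆ W`. -/
def SignedTuple.res {T : Finset (Place F)} {k : ℕ} {W' W : Finset (InfinitePlace F)}
    (h : W' ⊆ W) (p : SignedTuple T k W) : SignedTuple T k W' :=
  ⟨(fun w => p.1.1 ⟨w.1, h w.2⟩, p.1.2), fun i => funext fun w => congrFun (p.2 i) ⟨w.1, h w.2⟩⟩

lemma signedD_res {T : Finset (Place F)} {k : ℕ} {W' W : Finset (InfinitePlace F)} (h : W' ⊆ W)
    (c : SignedChain T (k + 1) W) :
    signedD T k W' (Finsupp.lmapDomain ℤ ℤ (SignedTuple.res h) c) =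
      Finsupp.lmapDomain ℤ ℤ (SignedTuple.res h) (signedD T k W c) := by
  induction c using Finsupp.induction_linear with
  | zero => simp only [map_zero]
  | add a b ha hb => simp only [map_add, ha, hb]
  | single t r =>
    simp only [signedD, Finsupp.lmapDomain_apply, Finsupp.mapDomain_single,
      Finsupp.linearCombination_single, Finsupp.mapDomain_smul, Finsupp.mapDomain_finsetSum]
    rfl

/-- The natural map `𝒦_W → 𝒦_{W'}`, `Λ⟦g⟧ ↦ Λ⟦g|_{W'}⟧`, for `W' ⊆ W`. -/
def resK (T : Finset (Place F)) {W' W : Finset (InfinitePlace F)} (h : W' ⊆ W) :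
    KMod T W →ₗ[ℤ] KMod T W' :=
  Submodule.mapQ _ _ (Finsupp.lmapDomain ℤ ℤ (SignedTuple.res h)) fun c hc => by
    rw [Submodule.mem_comap, LinearMap.mem_ker, signedD_res, LinearMap.mem_ker.mp hc, map_zero]

lemma resK_repK (T : Finset (Place F)) {W' W : Finset (InfinitePlace F)} (h : W' ⊆ W)
    (x : unitsPrimeTo T) (a : KMod T W) : resK T h (repK T W x a) = repK T W' x (resK T h a) := by
  obtain ⟨c, rfl⟩ := KMod.mk_surjective T W a
  refine congrArg (KMod.mk T W') ?_
  induction c using Finsupp.induction_linear with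
  | zero => simp only [map_zero]
  | add a b ha hb => simp only [map_add, ha, hb]
  | single t r =>
    change Finsupp.lmapDomain ℤ ℤ (SignedTuple.res h) (signedRep T _ W x (Finsupp.single t r)) =
      signedRep T _ W' x (Finsupp.lmapDomain ℤ ℤ (SignedTuple.res h) (Finsupp.single t r))
    rw [signedRep_apply, signedRep_apply, map_smul]
    simp only [Finsupp.lmapDomain_apply, Finsupp.mapDomain_single]
    rfl

/-- The inclusion of the basis of `C_k(F_g)` in that of `C_{k,W}`. -/
def SignedTuple.ofClass {T : Finset (Place F)} {k : ℕ} {W : Finset (InfinitePlace F)}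
    (g : SignGroup W) (t : Fin k → SignClass T g) : SignedTuple T k W :=
  ⟨(g, fun i => (t i).1), fun i => (t i).2⟩

lemma signedD_ofClass {T : Finset (Place F)} {k : ℕ} {W : Finset (InfinitePlace F)}
    (g : SignGroup W) (c : Chain (SignClass T g) (k + 1)) :
    signedD T k W (Finsupp.lmapDomain ℤ ℤ (SignedTuple.ofClass g) c) =
      Finsupp.lmapDomain ℤ ℤ (SignedTuple.ofClass g) (chainD (SignClass T g) k c) := by
  induction c using Finsupp.induction_linear with
  | zero => simp only [map_zero]
  | add a b ha hb => simp only [map_add, ha, hb]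
  | single t r =>
    simp only [signedD, chainD, Finsupp.lmapDomain_apply, Finsupp.mapDomain_single,
      Finsupp.linearCombination_single, Finsupp.mapDomain_smul, Finsupp.mapDomain_finsetSum]
    rfl

/-- The map `𝒞(F_g) → 𝒦_W`, `D ↦ D⟦g⟧`. -/
def bracket (T : Finset (Place F)) {W : Finset (InfinitePlace F)} (g : SignGroup W) :
    ConeMod F (SignClass T g) →ₗ[ℤ] KMod T W :=
  Submodule.mapQ _ _ (Finsupp.lmapDomain ℤ ℤ (SignedTuple.ofClass g)) fun c hc => by
    rw [Submodule.mem_comap, LinearMap.mem_ker, signedD_ofClass, LinearMap.mem_ker.mp hc, map_zero]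

/-- The element `∏_{p ∈ W} (1 - [p]) ∏_{p ∈ T} (1 - N(p)[p])` of `ℤ[I_F]`. -/
def delta (T : Finset (Place F)) (W : Finset (HeightOneSpectrum (𝓞 F))) :
    MonoidAlgebra ℤ (FracIdeals F) :=
  (∏ p ∈ W, (1 - MonoidAlgebra.single (primeIdeal p) 1)) *
    ∏ p ∈ T.toRight, (1 - MonoidAlgebra.single (primeIdeal p) (norm p : ℤ))

/-- `𝒜_W`: the `ℤ[I_(T)]`-submodule of `ℤ[I_F]` generated by `delta T W`, that is the additive
group generated by the elements `[𝔞] * delta T W` with `𝔞 ∈ I_(T)`. -/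
def AMod (T : Finset (Place F)) (W : Finset (HeightOneSpectrum (𝓞 F))) :
    Submodule ℤ (MonoidAlgebra ℤ (FracIdeals F)) :=
  Submodule.span ℤ
    (Set.range fun I : idealsPrimeTo T => MonoidAlgebra.single I.1 (1 : ℤ) * delta T W)

lemma single_mul_delta_mem {T : Finset (Place F)} (W : Finset (HeightOneSpectrum (𝓞 F)))
    {I : FracIdeals F} (hI : I ∈ idealsPrimeTo T) :
    MonoidAlgebra.single I (1 : ℤ) * delta T W ∈ AMod T W :=
  Submodule.subset_span ⟨⟨I, hI⟩, rfl⟩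

lemma single_mul_mem_AMod {T : Finset (Place F)} {W : Finset (HeightOneSpectrum (𝓞 F))}
    {I : FracIdeals F} (hI : I ∈ idealsPrimeTo T) {y : MonoidAlgebra ℤ (FracIdeals F)}
    (hy : y ∈ AMod T W) : MonoidAlgebra.single I (1 : ℤ) * y ∈ AMod T W := by
  induction hy using Submodule.span_induction with
  | mem y hy =>
    obtain ⟨J, rfl⟩ := hy
    rw [← mul_assoc, MonoidAlgebra.single_mul_single, one_mul]
    exact single_mul_delta_mem W (mul_mem hI J.2)
  | zero => rw [mul_zero]; exact zero_mem _
  | add a b _ _ ha hb => rw [mul_add]; exact add_mem ha hb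
  | smul c a _ ha => rw [mul_smul_comm]; exact Submodule.smul_mem _ c ha

/-- The action of `F_(T)` on `𝒜_W`: `x` acts as multiplication by `[(x)]`. -/
def repA (T : Finset (Place F)) (W : Finset (HeightOneSpectrum (𝓞 F))) :
    Representation ℤ (unitsPrimeTo T) (AMod T W) where
  toFun x := (LinearMap.mulLeft ℤ (MonoidAlgebra.single (principal F x.1) (1 : ℤ))).restrict
    fun _ hy => single_mul_mem_AMod x.2 hy
  map_one' := by
    ext1 y
    refine Subtype.ext ?_
    simp [← MonoidAlgebra.one_def]
  map_mul' x y := by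
    refine LinearMap.ext fun z => Subtype.ext ?_
    change MonoidAlgebra.single (principal F (x.1 * y.1)) (1 : ℤ) * z.1 =
      MonoidAlgebra.single (principal F x.1) (1 : ℤ) *
        (MonoidAlgebra.single (principal F y.1) (1 : ℤ) * z.1)
    rw [← mul_assoc, MonoidAlgebra.single_mul_single, map_mul, one_mul]

lemma AMod_le {T : Finset (Place F)} {W' W : Finset (HeightOneSpectrum (𝓞 F))} (h : W' ⊆ W)
    (hW : ∀ p ∈ W, ∀ q ∈ T.toRight, residueChar p ≠ residueChar q) : AMod T W ≤ AMod T W' := by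
  have key : ∀ U : Finset (HeightOneSpectrum (𝓞 F)),
      (∀ p ∈ U, ∀ q ∈ T.toRight, residueChar p ≠ residueChar q) → ∀ y ∈ AMod T W',
        (∏ p ∈ U, (1 - MonoidAlgebra.single (primeIdeal p) (1 : ℤ))) * y ∈ AMod T W' := by
    intro U
    induction U using Finset.cons_induction with
    | empty => intro _ y hy; rwa [Finset.prod_empty, one_mul]
    | cons p U hp ih =>
      intro hU y hy
      have h := ih (fun q hq => hU q (Finset.mem_cons_of_mem hq)) y hy
      rw [Finset.prod_cons, mul_assoc, sub_mul, one_mul]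
      exact sub_mem h (single_mul_mem_AMod
        (primeIdeal_mem_idealsPrimeTo (hU p (Finset.mem_cons_self p U))) h)
  classical
  refine Submodule.span_le.mpr ?_
  rintro _ ⟨I, rfl⟩
  refine single_mul_mem_AMod I.2 ?_
  rw [delta, ← Finset.prod_sdiff h, mul_assoc]
  refine key _ (fun p hp => hW p (Finset.sdiff_subset hp)) _ ?_
  have h1 := single_mul_delta_mem W' (one_mem (idealsPrimeTo T))
  rwa [← MonoidAlgebra.one_def, one_mul] at h1

lemma repA_coe (T : Finset (Place F)) (W : Finset (HeightOneSpectrum (𝓞 F)))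
    (x : unitsPrimeTo T) (a : AMod T W) :
    (repA T W x a : MonoidAlgebra ℤ (FracIdeals F)) =
      MonoidAlgebra.single (principal F x.1) (1 : ℤ) * a :=
  rfl

lemma inclusion_repA {T : Finset (Place F)} {W' W : Finset (HeightOneSpectrum (𝓞 F))}
    (h : AMod T W ≤ AMod T W') (x : unitsPrimeTo T) (a : AMod T W) :
    Submodule.inclusion h (repA T W x a) = repA T W' x (Submodule.inclusion h a) := by
  refine Subtype.ext ?_
  rw [Submodule.coe_inclusion, repA_coe, repA_coe, Submodule.coe_inclusion]

/-- `W̄ = W ∪ (S ∖ V)` for `W ⊆ V`. -/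
def bar (S V W : Finset (Place F)) : Finset (Place F) := W ∪ (S \ V)

/-- `ℳ_W = 𝒦_{W̄ ∩ S_∞} ⊗ 𝒜_{W̄ ∩ S_f}`. -/
abbrev MMod (S T V W : Finset (Place F)) : Type _ :=
  KMod T (bar S V W).toLeft ⊗[ℤ] AMod T (bar S V W).toRight

/-- The diagonal action of `F_(T)` on `ℳ_W`. -/
def repM (S T V W : Finset (Place F)) : Representation ℤ (unitsPrimeTo T) (MMod S T V W) :=
  (repK T (bar S V W).toLeft).tprod (repA T (bar S V W).toRight)

lemma bar_mono (S V : Finset (Place F)) {W' W : Finset (Place F)} (h : W' ⊆ W) :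
    bar S V W' ⊆ bar S V W :=
  Finset.union_subset_union_left h

/-- The natural map `ℳ_W → ℳ_{W'}` for `W' ⊆ W ⊆ V`. -/
def resM {S T V : Finset (Place F)} (hVS : V ⊆ S) (hC1 : ConditionC1 S T V)
    {W' W : Finset (Place F)} (hW : W ⊆ V) (h : W' ⊆ W) : MMod S T V W →ₗ[ℤ] MMod S T V W' :=
  TensorProduct.map
    (resK T (Finset.toLeft_subset_toLeft (bar_mono S V h)))
    (Submodule.inclusion (AMod_le (Finset.toRight_subset_toRight (bar_mono S V h))
      fun p hp => hC1.residueChar_S_T p (Finset.toRight_subset_toRight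
        (Finset.union_subset (hW.trans hVS) Finset.sdiff_subset) hp)))

lemma resM_repM {S T V : Finset (Place F)} (hVS : V ⊆ S) (hC1 : ConditionC1 S T V)
    {W' W : Finset (Place F)} (hW : W ⊆ V) (h : W' ⊆ W) (x : unitsPrimeTo T) (a : MMod S T V W) :
    resM hVS hC1 hW h (repM S T V W x a) = repM S T V W' x (resM hVS hC1 hW h a) :=
  tprod_map_equivariant (resK_repK T _) (inclusion_repA _) x a

/-! ### The functor `B` -/

/-- `B(W) = (ℳ_W ⊗ ℤ[N^S] ⊗ ℤ[Fˣ]) / 𝒩`, where `𝒩` is generated by the elements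
`x⁻¹a ⊗ i^S(x)b ⊗ c - a ⊗ b ⊗ xc` with `x ∈ F_(T)`. -/
abbrev B (S T V W : Finset (Place F)) : Type _ :=
  Induced (repM S T V W) ((iS S).comp (unitsPrimeTo T).subtype) (unitsPrimeTo T).subtype

/-- The action `x(a ⊗ b ⊗ c) = a ⊗ b ⊗ xc` of `Fˣ` on `B(W)`. -/
def repB (S T V W : Finset (Place F)) : Representation ℤ Fˣ (B S T V W) :=
  Induced.rep _ _ _

/-- `r^W_{W'} : B(W) → B(W')` for `W' ⊆ W ⊆ V`. -/
def resB {S T V : Finset (Place F)} (hVS : V ⊆ S) (hC1 : ConditionC1 S T V)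
    {W' W : Finset (Place F)} (hW : W ⊆ V) (h : W' ⊆ W) : B S T V W →ₗ[ℤ] B S T V W' :=
  Induced.map _ _ (resM hVS hC1 hW h) (resM_repM hVS hC1 hW h)

/-- `r^W_{W'}` is `Fˣ`-equivariant. -/
lemma resB_repB {S T V : Finset (Place F)} (hVS : V ⊆ S) (hC1 : ConditionC1 S T V)
    {W' W : Finset (Place F)} (hW : W ⊆ V) (h : W' ⊆ W) (x : Fˣ) (a : B S T V W) :
    resB hVS hC1 hW h (repB S T V W x a) = repB S T V W' x (resB hVS hC1 hW h a) :=
  Induced.map_rep _ _ _ _ x a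

/-! ### The element `ϑ` -/

/-- `F_{g_0}`: the elements of `F_(T)` that are positive at all places in `V̄ ∩ S_∞`, which is
`S_∞` if `V ⊆ S` and `S_∞ ⊆ S`. -/
abbrev PosClass (S T V : Finset (Place F)) : Type _ :=
  SignClass T (1 : SignGroup (bar S V V).toLeft)

/-- The element `(D⟦g_0⟧ ⊗ 𝔞⁻¹ δ_{S,T}) ⊗ ι(𝔞) ⊗ 1` of `B(V)`; here `V̄ = S`, hence
`δ_{S,T} = delta T (V̄ ∩ S_f)`. -/
def thetaTerm (S T V : Finset (Place F)) (D : ConeMod F (PosClass S T V))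
    (I : idealsPrimeTo T) : B S T V V :=
  Induced.mk _ _ _
    ((bracket T 1 D ⊗ₜ[ℤ]
      (⟨MonoidAlgebra.single (I⁻¹).1 (1 : ℤ) * delta T (bar S V V).toRight,
        single_mul_delta_mem _ (I⁻¹).2⟩ : AMod T (bar S V V).toRight)) ⊗ₜ[ℤ]
      MonoidAlgebra.single (iota S I.1) (1 : ℤ) ⊗ₜ[ℤ] (1 : MonoidAlgebra ℤ Fˣ))

/-- `t` is a class `ϑ = ∑_C ϑ_C` in `B(V) / I B(V)` attached to `η ∈ H_{n-1}(E_+, ℤ)`: the sum,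
over the narrow ideal classes `C`, of the classes of `(D⟦g_0⟧ ⊗ 𝔞⁻¹ δ_{S,T}) ⊗ ι(𝔞) ⊗ 1` for some
`𝔞 ∈ C ∩ I_(T)` and some `D ∈ 𝒞(F_{g_0}) ∩ Y(η)`. -/
def IsTheta (S T V : Finset (Place F)) (η : HomologyOf (posUnits F))
    (t : (repB S T V V).Coinvariants) : Prop :=
  ∃ (D : NarrowClassGroup F → ConeMod F (PosClass S T V))
    (I : NarrowClassGroup F → idealsPrimeTo T),
    (∀ C, chainModMap (fun x : PosClass S T V => (x.1 : Fˣ)) _ (D C) ∈ cyclesInClass η) ∧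
    (∀ C, (QuotientGroup.mk (I C).1 : NarrowClassGroup F) = C) ∧
    t = ∑ᶠ C, Representation.Coinvariants.mk (repB S T V V) (thetaTerm S T V (D C) (I C))

end Modules

end

end Shintani

/-!
Write `[m, s]` for the class of `m ⊗ s ⊗ 1` in `B(W) / I B(W)`. The relations that define `B(W)`
become `[x m, s] = [m, i^S(x) s]` for `x ∈ F_(T)` (`tensorClass_repM`). Let `W = V ∖ {v}`, and let
`f(C) = [c⟦1⟧ ⊗ 𝔞⁻¹ δ_W, ι(𝔞)]`, where `c` is the image of the chain `D` and `δ_W` is the product for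
the finite places in `W̄` (`thetaOn`). If `x ∈ F_(T)` is positive on `W̄`, then replacing `𝔞` by
`x 𝔞` amounts to replacing `c` by `sgn(x) x c`. Translation by `x` is homotopic to the identity (the
prism operator, `chainD_prism`), and units act on `ℳ_W` through the first factor only, so `x c` may
be replaced by `c`. Hence `f(C)` depends only on the class `η` and on `C` (`thetaOn_eq_of_mk_eq`).
That two chains in the class `η` differ by an element of the augmentation submodule already over the
elements positive on `W̄`, and not just over `Fˣ`, is seen by means of an `E_+`-equivariant
retraction (`exists_retraction_units`).

If `v = p` is finite, then `δ_V = (1 - [p]) δ_W` and `ι(p) = 1`, so that the sum in question is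
`∑_C f(C) - ∑_C f([p]⁻¹ C) = 0`.

If `v` is infinite, weak approximation yields an `x ∈ F_(T)` that is negative at `v` and positive at
all other infinite places (`exists_signAt_eq_neg_one`), and `f([x] C) = -f(C)`. If `(x)` is not
trivial in the narrow class group, the terms cancel in pairs. Otherwise there is a unit `ε` that is
negative exactly at `v`; the terms are then killed by `2`, because `ε` acts on the coinvariants both
as the identity and as `-1`. To see that they vanish, let `E'` be the group of units that are
positive outside `v`. As `V` does not contain all infinite places, `E'` is torsion-free, hence free
of rank at most `n - 1`, where `n = [F : ℚ]`. The homology of `E'` with coefficients `ℤ/2` therefore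
vanishes in degree `n` (`modTwoExactAt_of_free`), and so the homology of `E'` in degree `n - 1` with
coefficients in `ℤ` twisted by `sgn` has no `2`-torsion (`mem_of_two_smul_mem`). It follows that
each `f(C)` is zero (`thetaOn_eq_zero_of_unit`).
-/

namespace Shintani

attribute [local instance 10] AddCommGroup.toIntModule

set_option linter.unusedSectionVars false

noncomputable section

/-! ### The complex of chains on a set -/

section ChainComplex

variable {X Y : Type*}

/-- The cone operator `(x_1, …, x_k) ↦ (p, x_1, …, x_k)`, a contracting homotopy of the complex of
chains. -/
def cone (p : X) (k : ℕ) : Chain X k →ₗ[ℤ] Chain X (k + 1) :=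
  Finsupp.lmapDomain ℤ ℤ (Fin.cons (α := fun _ => X) p)

lemma cone_single (p : X) {k : ℕ} (t : Fin k → X) (r : ℤ) :
    cone p k (Finsupp.single t r) = Finsupp.single (Fin.cons (α := fun _ => X) p t) r :=
  Finsupp.mapDomain_single

lemma chainMap_single (f : X → Y) {k : ℕ} (t : Fin k → X) (r : ℤ) :
    chainMap f k (Finsupp.single t r) = Finsupp.single (f ∘ t) r :=
  Finsupp.mapDomain_single

lemma chainD_single {k : ℕ} (t : Fin (k + 1) → X) :
    chainD X k (Finsupp.single t 1) =
      ∑ i : Fin (k + 1), (-1 : ℤ) ^ (i : ℕ) • Finsupp.single (i.removeNth t) (1 : ℤ) := by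
  rw [chainD, Finsupp.linearCombination_single, one_smul]

/-- Chains of positive length are spanned by cones. -/
lemma Chain.hom_ext_cone {M : Type*} [AddCommGroup M] {k : ℕ}
    {f g : Chain X (k + 1) →ₗ[ℤ] M}
    (h : ∀ p (t : Fin k → X), f (cone p k (Finsupp.single t 1)) = g (cone p k (Finsupp.single t 1))) :
    f = g := by
  refine Finsupp.lhom_ext' fun t => LinearMap.ext_ring ?_
  have := h (t 0) (Fin.tail t)
  rwa [cone_single, Fin.cons_self_tail] at this

lemma Chain.hom_ext_single {M : Type*} [AddCommGroup M] {k : ℕ} {f g : Chain X k →ₗ[ℤ] M}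
    (h : ∀ t : Fin k → X, f (Finsupp.single t 1) = g (Finsupp.single t 1)) : f = g :=
  Finsupp.lhom_ext' fun t => LinearMap.ext_ring (h t)

lemma chainD_cone_zero (p : X) : chainD X 0 ∘ₗ cone p 0 = LinearMap.id := by
  refine Chain.hom_ext_single fun t => ?_
  rw [LinearMap.comp_apply, cone_single, chainD_single, LinearMap.id_apply]
  rw [Fin.sum_univ_one, Subsingleton.elim (Fin.removeNth _ _) t]
  simp

lemma chainD_cone (p : X) (k : ℕ) :
    chainD X (k + 1) ∘ₗ cone p (k + 1) = LinearMap.id - cone p k ∘ₗ chainD X k := by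
  refine Chain.hom_ext_single fun t => ?_
  rw [LinearMap.comp_apply, cone_single, chainD_single, Fin.sum_univ_succ, LinearMap.sub_apply,
    LinearMap.comp_apply, chainD_single, map_sum, sub_eq_add_neg, ← Finset.sum_neg_distrib]
  congr 1
  · simp
  · refine Finset.sum_congr rfl fun i _ => ?_
    have h : (i.succ.removeNth (Fin.cons (α := fun _ => X) p t) : Fin (k + 1) → X) =
        Fin.cons (α := fun _ => X) p (i.removeNth t) := by
      funext j
      refine Fin.cases ?_ (fun j => ?_) j
      · simp [Fin.removeNth]
      · simp [Fin.removeNth]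
    rw [h, map_smul, cone_single, Fin.val_succ, pow_succ, mul_neg_one, neg_smul]

lemma chainD_cone_apply (p : X) {k : ℕ} (c : Chain X (k + 1)) :
    chainD X (k + 1) (cone p (k + 1) c) = c - cone p k (chainD X k c) :=
  LinearMap.congr_fun (chainD_cone p k) c

lemma chainD_comp_chainD (X : Type*) (k : ℕ) : chainD X k ∘ₗ chainD X (k + 1) = 0 := by
  induction k with
  | zero =>
    refine Chain.hom_ext_cone fun p t => ?_
    rw [LinearMap.comp_apply, chainD_cone_apply, map_sub, LinearMap.zero_apply, sub_eq_zero]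
    exact (LinearMap.congr_fun (chainD_cone_zero p) _).symm
  | succ k ih =>
    refine Chain.hom_ext_cone fun p t => ?_
    rw [LinearMap.comp_apply, chainD_cone_apply, map_sub, chainD_cone_apply, LinearMap.zero_apply]
    have := LinearMap.congr_fun ih (Finsupp.single t 1)
    rw [LinearMap.comp_apply, LinearMap.zero_apply] at this
    rw [this, map_zero, sub_zero, sub_self]

lemma chainD_chainD {k : ℕ} (c : Chain X (k + 2)) : chainD X k (chainD X (k + 1) c) = 0 :=
  LinearMap.congr_fun (chainD_comp_chainD X k) c

/-- The augmented complex of chains on a nonempty set is exact. -/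
lemma exists_chainD_eq [Nonempty X] {k : ℕ} {c : Chain X (k + 1)} (hc : chainD X k c = 0) :
    ∃ z, chainD X (k + 1) z = c := by
  obtain ⟨p⟩ := ‹Nonempty X›
  exact ⟨cone p (k + 1) c, by rw [chainD_cone_apply, hc, map_zero, sub_zero]⟩

lemma ker_chainD [Nonempty X] (k : ℕ) :
    LinearMap.ker (chainD X k) = LinearMap.range (chainD X (k + 1)) :=
  le_antisymm (fun _ hc => exists_chainD_eq hc) (by
    rintro _ ⟨z, rfl⟩
    exact chainD_chainD z)

lemma chainMap_cone (f : X → Y) (p : X) (k : ℕ) (c : Chain X k) :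
    chainMap f (k + 1) (cone p k c) = cone (f p) k (chainMap f k c) := by
  refine LinearMap.congr_fun (f := chainMap f (k + 1) ∘ₗ cone p k)
    (g := cone (f p) k ∘ₗ chainMap f k) (Chain.hom_ext_single fun t => ?_) c
  simp only [LinearMap.comp_apply, cone_single, chainMap_single]
  congr 1
  funext j
  refine Fin.cases ?_ (fun j => ?_) j <;> simp

/-- The prism operator attached to a self-map `f` of `X`: a homotopy from the identity to `f`,
given by `(x_1, …, x_k) ↦ ∑ ± (x_1, …, x_i, f x_i, …, f x_k)`. It is defined recursively by coning
from the first entry, and vanishes on `C_0`. -/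
def prism (f : X → X) : ∀ k : ℕ, Chain X k →ₗ[ℤ] Chain X (k + 1)
  | 0 => 0
  | k + 1 => Finsupp.linearCombination ℤ fun t =>
      cone (t 0) (k + 1) (Finsupp.single (f ∘ t) 1 - prism f k (Finsupp.single (Fin.tail t) 1))

lemma prism_single (f : X → X) {k : ℕ} (t : Fin (k + 1) → X) :
    prism f (k + 1) (Finsupp.single t 1) =
      cone (t 0) (k + 1) (Finsupp.single (f ∘ t) 1 - prism f k (Finsupp.single (Fin.tail t) 1)) := by
  rw [prism, Finsupp.linearCombination_single, one_smul]

lemma prism_cone (f : X → X) (p : X) {k : ℕ} (c : Chain X k) :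
    prism f (k + 1) (cone p k c) =
      cone p (k + 1) (chainMap f (k + 1) (cone p k c) - prism f k c) := by
  refine LinearMap.congr_fun (f := prism f (k + 1) ∘ₗ cone p k)
    (g := cone p (k + 1) ∘ₗ (chainMap f (k + 1) ∘ₗ cone p k - prism f k))
    (Chain.hom_ext_single fun t => ?_) c
  simp only [LinearMap.comp_apply, LinearMap.sub_apply, cone_single, prism_single,
    chainMap_single, Fin.cons_zero, Fin.tail_cons]

/-- The homotopy identity `d h + h d = f - 1`. -/
lemma chainD_prism (f : X → X) {k : ℕ} (c : Chain X (k + 1)) :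
    chainD X (k + 1) (prism f (k + 1) c) =
      chainMap f (k + 1) c - c - prism f k (chainD X k c) := by
  refine LinearMap.congr_fun (f := chainD X (k + 1) ∘ₗ prism f (k + 1))
    (g := chainMap f (k + 1) - LinearMap.id - prism f k ∘ₗ chainD X k) ?_ c
  clear c
  induction k with
  | zero =>
    refine Chain.hom_ext_cone fun p t => ?_
    have h := fun q => LinearMap.congr_fun (chainD_cone_zero (X := X) q)
    simp only [LinearMap.comp_apply, LinearMap.id_apply] at h
    simp only [LinearMap.comp_apply, LinearMap.sub_apply, LinearMap.id_apply, prism_cone,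
      chainD_cone_apply, map_sub]
    rw [chainMap_cone, h, h, chainMap_single, Subsingleton.elim (f ∘ t) t]
    simp only [prism, LinearMap.zero_apply, map_zero, sub_zero]
  | succ k ih =>
    refine Chain.hom_ext_cone fun p t => ?_
    have h := LinearMap.congr_fun ih (Finsupp.single t 1)
    simp only [LinearMap.comp_apply, LinearMap.sub_apply, LinearMap.id_apply] at h
    simp only [LinearMap.comp_apply, LinearMap.sub_apply, LinearMap.id_apply, prism_cone,
      chainD_cone_apply, chainD_chainMap, map_sub, h]
    abel

end ChainComplex

/-! ### Free group actions -/

section FreeAction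

lemma exists_orbit_section {E Y : Type*} [Group E] [MulAction E Y]
    (hfree : ∀ (e : E) (y : Y), e • y = y → e = 1) :
    ∃ (a : Y → E) (s : Y → Y), (∀ y, a y • s y = y) ∧
      (∀ (e : E) (y : Y), a (e • y) = e * a y) ∧ ∀ (e : E) (y : Y), s (e • y) = s y := by
  let s : Y → Y := fun y => (Quotient.mk (MulAction.orbitRel E Y) y).out
  have hs : ∀ (e : E) (y : Y), s (e • y) = s y := fun e y =>
    congrArg Quotient.out (Quotient.sound (s := MulAction.orbitRel E Y) ⟨e, rfl⟩)
  have h : ∀ y, ∃ e : E, e • s y = y := fun y =>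
    (MulAction.orbitRel E Y).symm (Quotient.mk_out (s := MulAction.orbitRel E Y) y)
  choose a ha using h
  refine ⟨a, s, ha, fun e y => ?_, hs⟩
  have h1 := ha (e • y)
  rw [hs] at h1
  have h2 : ((e * a y)⁻¹ * a (e • y)) • s y = s y := by
    rw [mul_smul, h1, inv_smul_eq_iff, mul_smul, ha]
  have h3 := hfree _ _ h2
  rwa [inv_mul_eq_one, eq_comm] at h3

/-- A subset of a free `E`-set that is stable under `E` is an equivariant retract: an orbit in the
complement can be sent to any orbit of the subset. -/
lemma exists_equivariant_retraction {E P Y : Type*} [Group E] [MulAction E P] [MulAction E Y]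
    (hfree : ∀ (e : E) (y : Y), e • y = y → e = 1) [Nonempty P] (i : P → Y)
    (hi : Function.Injective i) (hie : ∀ (e : E) p, i (e • p) = e • i p) :
    ∃ ρ : Y → P, (∀ (e : E) y, ρ (e • y) = e • ρ y) ∧ ∀ p, ρ (i p) = p := by
  classical
  obtain ⟨a, s, -, ha, -⟩ := exists_orbit_section hfree
  obtain ⟨p₀⟩ := ‹Nonempty P›
  have h : ∀ y, ∃ p, (∃ q, i q = y) ∧ i p = y ∨ (¬ ∃ q, i q = y) ∧ p = a y • p₀ := fun y => by
    by_cases hy : ∃ q, i q = y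
    · exact ⟨hy.choose, Or.inl ⟨hy, hy.choose_spec⟩⟩
    · exact ⟨_, Or.inr ⟨hy, rfl⟩⟩
  choose ρ hρ using h
  refine ⟨ρ, fun e y => ?_, fun p => ?_⟩
  · have hey : (∃ q, i q = e • y) ↔ ∃ q, i q = y :=
      ⟨fun ⟨q, hq⟩ => ⟨e⁻¹ • q, by rw [hie, hq, inv_smul_smul]⟩,
        fun ⟨q, hq⟩ => ⟨e • q, by rw [hie, hq]⟩⟩
    rcases hρ y with ⟨h1, h2⟩ | ⟨h1, h2⟩
    · rcases hρ (e • y) with ⟨-, h4⟩ | ⟨h3, -⟩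
      · exact hi (by rw [h4, hie, h2])
      · exact absurd (hey.mpr h1) h3
    · rcases hρ (e • y) with ⟨h3, -⟩ | ⟨-, h4⟩
      · exact absurd (hey.mp h3) h1
      · rw [h4, h2, ha, mul_smul]
  · rcases hρ (i p) with ⟨-, h2⟩ | ⟨h1, -⟩
    · exact hi h2
    · exact absurd ⟨p, rfl⟩ h1

lemma free_pi {E X : Type*} [Group E] [MulAction E X]
    (hfree : ∀ (e : E) (x : X), e • x = x → e = 1) {k : ℕ} (e : E) (t : Fin (k + 1) → X)
    (h : e • t = t) : e = 1 :=
  hfree e (t 0) (congrFun h 0)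

end FreeAction

/-! ### Twisted augmentation submodules -/

section Augmentation

variable {G : Type*} [CommGroup G]

/-- The submodule of the free abelian group on the `G`-set `Y` generated by the elements
`χ(a) [a y] - [y]` with `a` in the subgroup `A`. The quotient by it is the group of coinvariants
under `A` of the permutation module twisted by the sign character `χ`. -/
def augSub (χ : G →* ℤˣ) (A : Subgroup G) (Y : Type*) [MulAction G Y] : Submodule ℤ (Y →₀ ℤ) :=
  Submodule.span ℤ {z | ∃ a ∈ A, ∃ y : Y,
    z = ((χ a : ℤˣ) : ℤ) • Finsupp.single (a • y) (1 : ℤ) - Finsupp.single y 1}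

variable {Y : Type*} [MulAction G Y] (χ : G →* ℤˣ) {A : Subgroup G}

lemma twisted_sub_mem_augSub {a : G} (ha : a ∈ A) (c : Y →₀ ℤ) :
    ((χ a : ℤˣ) : ℤ) • Finsupp.mapDomain (a • ·) c - c ∈ augSub χ A Y := by
  induction c using Finsupp.induction_linear with
  | zero => simp
  | add c d hc hd =>
    rw [Finsupp.mapDomain_add, smul_add, add_sub_add_comm]
    exact add_mem hc hd
  | single y r =>
    have h := Submodule.smul_mem (augSub χ A Y) r (Submodule.subset_span ⟨a, ha, y, rfl⟩)
    rw [smul_sub, smul_comm, Finsupp.smul_single_one, Finsupp.smul_single_one] at h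
    rwa [Finsupp.mapDomain_single]

lemma sub_mem_augSub {a : G} (ha : a ∈ A) (c : Y →₀ ℤ) :
    Finsupp.mapDomain (a • ·) c - c ∈ augSub (1 : G →* ℤˣ) A Y := by
  simpa using twisted_sub_mem_augSub 1 ha c

lemma augSub_mono {A' : Subgroup G} (h : A ≤ A') : augSub χ A Y ≤ augSub χ A' Y :=
  Submodule.span_mono fun _ ⟨a, ha, y, hz⟩ => ⟨a, h ha, y, hz⟩

/-- Two characters that agree on `A` have the same augmentation submodule. -/
lemma augSub_congr {χ' : G →* ℤˣ} (h : ∀ a ∈ A, χ a = χ' a) : augSub χ A Y = augSub χ' A Y := by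
  refine le_antisymm (Submodule.span_le.mpr ?_) (Submodule.span_le.mpr ?_)
  · rintro _ ⟨a, ha, y, rfl⟩
    exact Submodule.subset_span ⟨a, ha, y, by rw [h a ha]⟩
  · rintro _ ⟨a, ha, y, rfl⟩
    exact Submodule.subset_span ⟨a, ha, y, by rw [h a ha]⟩

/-- For a free action, the twisted coinvariants are a free abelian group, hence have no
`2`-torsion. -/
lemma mem_augSub_of_two_smul_mem (hfree : ∀ (g : G) (y : Y), g • y = y → g = 1) {u : Y →₀ ℤ}
    (hu : (2 : ℤ) • u ∈ augSub χ A Y) : u ∈ augSub χ A Y := by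
  obtain ⟨a, s, has, ha, hs⟩ := exists_orbit_section (E := A) (Y := Y)
    fun e y h => Subtype.ext (hfree e.1 y h)
  -- the normal form with respect to the chosen representatives of the orbits
  let ψ : (Y →₀ ℤ) →ₗ[ℤ] (Y →₀ ℤ) := Finsupp.linearCombination ℤ fun y =>
    ((χ (a y).1 : ℤˣ) : ℤ) • Finsupp.single (s y) (1 : ℤ)
  have hψ1 : ∀ y, ψ (Finsupp.single y 1) = ((χ (a y).1 : ℤˣ) : ℤ) • Finsupp.single (s y) (1 : ℤ) :=
    fun y => by
      simp only [ψ]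
      rw [Finsupp.linearCombination_single, one_smul]
  have hψ : augSub χ A Y ≤ LinearMap.ker ψ := by
    refine Submodule.span_le.mpr ?_
    rintro _ ⟨b, hb, y, rfl⟩
    have h1 := ha ⟨b, hb⟩ y
    have h2 := hs ⟨b, hb⟩ y
    change a (b • y) = _ at h1
    change s (b • y) = _ at h2
    rw [SetLike.mem_coe, LinearMap.mem_ker, map_sub, map_smul, hψ1, hψ1, h1, h2, smul_smul,
      Subgroup.coe_mul, map_mul, ← Units.val_mul, ← mul_assoc, Int.units_mul_self, one_mul,
      sub_self]
  have hsub : ∀ c, c - ψ c ∈ augSub χ A Y := fun c => by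
    induction c using Finsupp.induction_linear with
    | zero => simp
    | add c d hc hd =>
      rw [map_add, add_sub_add_comm]
      exact add_mem hc hd
    | single y r =>
      have h := Submodule.smul_mem (augSub χ A Y) (r * ((χ (a y).1 : ℤˣ) : ℤ))
        (Submodule.subset_span ⟨(a y).1, (a y).2, s y, rfl⟩)
      have h1 : (a y).1 • s y = y := has y
      rw [h1, mul_smul, smul_sub, smul_smul, ← Units.val_mul, Int.units_mul_self, Units.val_one,
        one_smul, ← hψ1, smul_sub, ← map_smul, Finsupp.smul_single_one] at h
      exact h
  have h := LinearMap.mem_ker.mp (hψ hu)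
  rw [map_smul, smul_eq_zero] at h
  have h1 := hsub u
  rwa [h.resolve_left two_ne_zero, sub_zero] at h1

/-- Modulo `2`, the augmentation submodule does not depend on the character. -/
lemma augSub_le_two_sup (χ' : G →* ℤˣ) :
    augSub χ A Y ≤ LinearMap.range ((2 : ℤ) • (LinearMap.id : (Y →₀ ℤ) →ₗ[ℤ] _)) ⊔
      augSub χ' A Y := by
  refine Submodule.span_le.mpr ?_
  rintro _ ⟨a, ha, y, rfl⟩
  have h : ∃ r : ℤ, ((χ a : ℤˣ) : ℤ) = 2 * r + ((χ' a : ℤˣ) : ℤ) := by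
    rcases Int.units_eq_one_or (χ a) with h1 | h1 <;> rcases Int.units_eq_one_or (χ' a) with h2 | h2
    · exact ⟨0, by simp [h1, h2]⟩
    · exact ⟨1, by simp [h1, h2]⟩
    · exact ⟨-1, by simp [h1, h2]⟩
    · exact ⟨0, by simp [h1, h2]⟩
  obtain ⟨r, hr⟩ := h
  rw [hr, add_smul, add_sub_assoc, mul_smul]
  exact Submodule.add_mem_sup ⟨_, rfl⟩ (Submodule.subset_span ⟨a, ha, y, rfl⟩)

end Augmentation

/-! ### Chains on a set with a group action -/

section EquivariantChains

variable {G X : Type*} [CommGroup G] [MulAction G X] (χ : G →* ℤˣ) {A : Subgroup G}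

lemma chainD_mem_augSub {k : ℕ} {c : Chain X (k + 1)} (hc : c ∈ augSub χ A (Fin (k + 1) → X)) :
    chainD X k c ∈ augSub χ A (Fin k → X) := by
  refine (Submodule.span_le (p := (augSub χ A (Fin k → X)).comap (chainD X k))).mpr ?_ hc
  rintro _ ⟨a, ha, t, rfl⟩
  rw [SetLike.mem_coe, Submodule.mem_comap, map_sub, map_smul]
  have h : Finsupp.single (a • t) (1 : ℤ) = chainMap (a • · : X → X) (k + 1) (Finsupp.single t 1) :=
    (chainMap_single (a • · : X → X) t 1).symm
  rw [h, chainD_chainMap]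
  exact twisted_sub_mem_augSub χ ha _

lemma prism_chainMap {f g : X → X} (hfg : ∀ x, f (g x) = g (f x)) {k : ℕ} (c : Chain X k) :
    prism f k (chainMap g k c) = chainMap g (k + 1) (prism f k c) := by
  induction k with
  | zero => simp [prism]
  | succ k ih =>
    refine LinearMap.congr_fun (f := prism f (k + 1) ∘ₗ chainMap g (k + 1))
      (g := chainMap g (k + 2) ∘ₗ prism f (k + 1)) (Chain.hom_ext_cone fun p t => ?_) c
    have hfg' : f ∘ g = g ∘ f := funext hfg
    have e : ∀ t : Fin k → X, f ∘ g ∘ t = g ∘ f ∘ t := fun t => by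
      rw [← Function.comp_assoc, hfg', Function.comp_assoc]
    simp only [LinearMap.comp_apply, chainMap_cone, prism_cone, map_sub, ← ih, hfg, chainMap_single, e]

lemma prism_mem_augSub (h : G) {k : ℕ} {c : Chain X k} (hc : c ∈ augSub χ A (Fin k → X)) :
    prism (h • · : X → X) k c ∈ augSub χ A (Fin (k + 1) → X) := by
  refine (Submodule.span_le
    (p := (augSub χ A (Fin (k + 1) → X)).comap (prism (h • · : X → X) k))).mpr ?_ hc
  rintro _ ⟨a, ha, t, rfl⟩
  rw [SetLike.mem_coe, Submodule.mem_comap, map_sub, map_smul]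
  have e : Finsupp.single (a • t) (1 : ℤ) = chainMap (a • · : X → X) k (Finsupp.single t 1) :=
    (chainMap_single (a • · : X → X) t 1).symm
  rw [e, prism_chainMap (fun x => smul_comm h a x)]
  exact twisted_sub_mem_augSub χ ha _

/-- Translation by `h` acts trivially on the homology of `A`. For `k = 0` the chain `c` is a cycle
for the complex without its augmentation term `C_0`, so that nothing is assumed. -/
lemma chainMap_smul_sub_mem (h : G) {k : ℕ} {c : Chain X (k + 1)}
    (hc : k ≠ 0 → chainD X k c ∈ augSub χ A (Fin k → X)) :
    chainMap (h • · : X → X) (k + 1) c - c ∈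
      augSub χ A (Fin (k + 1) → X) ⊔ LinearMap.range (chainD X (k + 1)) := by
  have e := chainD_prism (h • · : X → X) c
  rw [eq_sub_iff_add_eq, add_comm (chainD X (k + 1) _)] at e
  rw [← e]
  refine Submodule.add_mem_sup ?_ ⟨_, rfl⟩
  cases k with
  | zero =>
    rw [prism, LinearMap.zero_apply]
    exact zero_mem _
  | succ k => exact prism_mem_augSub χ h (hc k.succ_ne_zero)

end EquivariantChains

/-! ### Vanishing of homology modulo two above the rank -/

section ModTwo

variable {G : Type*} [CommGroup G]

/-- The kernel of the map from the free abelian group on `Y` to its coinvariants under `A` modulo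
`2`. -/
def modTwoAug (A : Subgroup G) (Y : Type*) [MulAction G Y] : Submodule ℤ (Y →₀ ℤ) :=
  LinearMap.range ((2 : ℤ) • (LinearMap.id : (Y →₀ ℤ) →ₗ[ℤ] _)) ⊔ augSub 1 A Y

variable {Y : Type*} [MulAction G Y] {A : Subgroup G}

lemma two_smul_mem_modTwoAug (c : Y →₀ ℤ) : (2 : ℤ) • c ∈ modTwoAug A Y :=
  Submodule.mem_sup_left ⟨c, rfl⟩

lemma exists_of_mem_modTwoAug {c : Y →₀ ℤ} (hc : c ∈ modTwoAug A Y) :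
    ∃ u, ∃ j ∈ augSub 1 A Y, c = (2 : ℤ) • u + j := by
  obtain ⟨_, ⟨u, rfl⟩, j, hj, rfl⟩ := Submodule.mem_sup.mp hc
  exact ⟨u, j, hj, rfl⟩

lemma modTwoAug_mono {A' : Subgroup G} (h : A ≤ A') : modTwoAug A Y ≤ modTwoAug A' Y :=
  sup_le_sup_left (augSub_mono 1 h) _

lemma exists_two_smul_of_even {Z : Type*} {v : Z →₀ ℤ} (h : ∀ w, (2 : ℤ) ∣ v w) :
    ∃ u, v = (2 : ℤ) • u := by
  refine ⟨v.mapRange (· / 2) (by simp), Finsupp.ext fun w => ?_⟩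
  rw [Finsupp.smul_apply, Finsupp.mapRange_apply, smul_eq_mul, Int.mul_ediv_cancel' (h w)]

/-- A chain lies in `modTwoAug A Y` if and only if its image in the free abelian group on the
orbits of `A` is divisible by `2`. -/
lemma mem_modTwoAug_iff {c : Y →₀ ℤ} :
    c ∈ modTwoAug A Y ↔
      ∀ w, (2 : ℤ) ∣ Finsupp.mapDomain (Quotient.mk (MulAction.orbitRel A Y)) c w := by
  set q := Quotient.mk (MulAction.orbitRel A Y)
  have hq : ∀ a ∈ A, ∀ y : Y, q (a • y) = q y := fun a ha y =>
    Quotient.sound (s := MulAction.orbitRel A Y) ⟨⟨a, ha⟩, rfl⟩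
  constructor
  · intro hc w
    obtain ⟨u, j, hj, rfl⟩ := exists_of_mem_modTwoAug hc
    have h : augSub 1 A Y ≤ LinearMap.ker (Finsupp.lmapDomain ℤ ℤ q) := by
      refine Submodule.span_le.mpr ?_
      rintro _ ⟨a, ha, y, rfl⟩
      rw [SetLike.mem_coe, LinearMap.mem_ker, map_sub, map_smul, Finsupp.lmapDomain_apply,
        Finsupp.lmapDomain_apply, Finsupp.mapDomain_single, Finsupp.mapDomain_single, hq a ha y,
        MonoidHom.one_apply, Units.val_one, one_smul, sub_self]
    have hj' : Finsupp.mapDomain q j = 0 := h hj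
    rw [Finsupp.mapDomain_add, hj', add_zero, Finsupp.mapDomain_smul]
    exact ⟨_, rfl⟩
  · intro h
    obtain ⟨u, hu⟩ := exists_two_smul_of_even h
    have hsub : ∀ c : Y →₀ ℤ, c - Finsupp.mapDomain Quotient.out (Finsupp.mapDomain q c) ∈
        augSub 1 A Y := fun c => by
      induction c using Finsupp.induction_linear with
      | zero => simp
      | add c d hc hd =>
        rw [Finsupp.mapDomain_add, Finsupp.mapDomain_add, add_sub_add_comm]
        exact add_mem hc hd
      | single y r =>
        obtain ⟨a, ha⟩ := (MulAction.orbitRel A Y).symm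
          (Quotient.mk_out (s := MulAction.orbitRel A Y) y)
        have h := sub_mem_augSub a.2 (Finsupp.single (q y).out r)
        rw [Finsupp.mapDomain_single] at h ⊢
        rw [Finsupp.mapDomain_single]
        change a.1 • (q y).out = y at ha
        rwa [ha] at h
    rw [← sub_add_cancel c (Finsupp.mapDomain Quotient.out (Finsupp.mapDomain q c))]
    refine add_mem (Submodule.mem_sup_right (hsub c)) ?_
    rw [hu, Finsupp.mapDomain_smul]
    exact two_smul_mem_modTwoAug _

lemma mapDomain_smul_mem_modTwoAug (g : G) {c : Y →₀ ℤ} (hc : c ∈ modTwoAug A Y) :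
    Finsupp.mapDomain (g • ·) c ∈ modTwoAug A Y := by
  obtain ⟨u, j, hj, rfl⟩ := exists_of_mem_modTwoAug hc
  rw [Finsupp.mapDomain_add, Finsupp.mapDomain_smul]
  refine add_mem (two_smul_mem_modTwoAug _) (Submodule.mem_sup_right ?_)
  refine (Submodule.span_le (p := (augSub 1 A Y).comap (Finsupp.lmapDomain ℤ ℤ (g • ·)))).mpr ?_ hj
  rintro _ ⟨a, ha, y, rfl⟩
  rw [SetLike.mem_coe, Submodule.mem_comap, map_sub, map_smul, Finsupp.lmapDomain_apply,
    Finsupp.lmapDomain_apply, Finsupp.mapDomain_single, Finsupp.mapDomain_single, smul_comm]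
  exact Submodule.subset_span ⟨a, ha, g • y, rfl⟩

/-- If `t` has infinite order modulo `A`, then it acts freely on the set of orbits of `A`, hence
`t - 1` is injective on the coinvariants modulo `2`: a finitely supported function invariant under
a translation with infinite orbits vanishes. -/
lemma mem_modTwoAug_of_smul_sub_mem (hfree : ∀ (g : G) (y : Y), g • y = y → g = 1) {t : G}
    (ht : ∀ m : ℤ, t ^ m ∈ A → m = 0) {u : Y →₀ ℤ}
    (hu : Finsupp.mapDomain (t • ·) u - u ∈ modTwoAug A Y) : u ∈ modTwoAug A Y := by
  rw [mem_modTwoAug_iff] at hu ⊢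
  let s := MulAction.orbitRel A Y
  let τ : ℕ → Quotient s → Quotient s := fun m => Quotient.map (t ^ m • ·) (by
    rintro _ y ⟨a, rfl⟩
    exact ⟨a, smul_comm a.1 (t ^ m) y⟩)
  have hτ : ∀ m y, τ m (Quotient.mk s y) = Quotient.mk s (t ^ m • y) := fun _ _ => rfl
  have hτ1 : Function.Injective (τ 1) := by
    intro w w'
    refine Quotient.inductionOn₂ w w' fun y y' h => ?_
    obtain ⟨a, ha⟩ := Quotient.exact (s := s) h
    refine Quotient.sound ⟨a, ?_⟩
    change a.1 • (t ^ 1 • y') = t ^ 1 • y at ha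
    change a.1 • y' = y
    rwa [smul_comm, smul_left_cancel_iff] at ha
  have hinj : ∀ w, Function.Injective fun m => τ m w := by
    intro w m m' h
    induction w using Quotient.inductionOn with | _ y => ?_
    obtain ⟨a, ha⟩ := Quotient.exact (s := s) h
    change a.1 • (t ^ m' • y) = t ^ m • y at ha
    have h1 : ((t ^ m)⁻¹ * (a.1 * t ^ m')) • y = y := by
      rw [mul_smul, mul_smul, ha, inv_smul_smul]
    have h2 := hfree _ _ h1
    have h3 : t ^ ((m : ℤ) - m') = a.1 := by
      rw [inv_mul_eq_one] at h2
      rw [zpow_sub, zpow_natCast, zpow_natCast, h2, mul_inv_cancel_right]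
    have := ht _ (h3 ▸ a.2)
    omega
  set v := Finsupp.mapDomain (Quotient.mk s) u with hv
  have hv1 : Finsupp.mapDomain (Quotient.mk s) (Finsupp.mapDomain (t • ·) u) =
      Finsupp.mapDomain (τ 1) v := by
    rw [hv, ← Finsupp.mapDomain_comp, ← Finsupp.mapDomain_comp]
    congr 1
    funext y
    change Quotient.mk s (t • y) = τ 1 (Quotient.mk s y)
    rw [hτ, pow_one]
  have hstep : ∀ w, (2 : ℤ) ∣ v w - v (τ 1 w) := by
    intro w
    have h := hu (τ 1 w)
    have e : Finsupp.mapDomain (Quotient.mk s) (Finsupp.mapDomain (t • ·) u - u) =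
        Finsupp.mapDomain (τ 1) v - v := by
      rw [← hv1, hv]
      exact map_sub (Finsupp.lmapDomain ℤ ℤ (Quotient.mk s)) _ _
    change (2 : ℤ) ∣ Finsupp.mapDomain (Quotient.mk s) _ _ at h
    rwa [e, Finsupp.sub_apply, Finsupp.mapDomain_apply hτ1] at h
  have hall : ∀ (m : ℕ) w, (2 : ℤ) ∣ v w - v (τ m w) := by
    intro m
    induction m with
    | zero =>
      intro w
      induction w using Quotient.inductionOn with | _ y => ?_
      rw [hτ, pow_zero, one_smul, sub_self]
      exact dvd_zero _
    | succ m ih =>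
      intro w
      have e : τ (m + 1) w = τ 1 (τ m w) := by
        induction w using Quotient.inductionOn with | _ y => ?_
        rw [hτ, hτ, hτ, smul_smul, pow_one, pow_succ']
      rw [e]
      have := dvd_add (ih w) (hstep (τ m w))
      rwa [sub_add_sub_cancel] at this
  intro w
  by_contra hw
  have hsupp : Set.range (fun m => τ m w) ⊆ v.support := by
    rintro _ ⟨m, rfl⟩
    refine Finsupp.mem_support_iff.mpr fun h0 => hw ?_
    have := hall m w
    rwa [h0, sub_zero] at this
  exact Set.infinite_range_of_injective (hinj w) (v.support.finite_toSet.subset hsupp)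

/-- The coinvariants under `⟨A, t⟩` are obtained from those under `A` by dividing out `t - 1`. -/
lemma modTwoAug_sup_zpowers_le (t : G) :
    modTwoAug (A ⊔ Subgroup.zpowers t) Y ≤
      modTwoAug A Y ⊔ LinearMap.range (Finsupp.lmapDomain ℤ ℤ (t • · : Y → Y) - LinearMap.id) := by
  set R := modTwoAug A Y ⊔ LinearMap.range (Finsupp.lmapDomain ℤ ℤ (t • · : Y → Y) - LinearMap.id)
  refine sup_le (fun c hc => Submodule.mem_sup_left (Submodule.mem_sup_left hc))
    (Submodule.span_le.mpr ?_)
  let H : Subgroup G :=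
    { carrier := {g | ∀ y : Y, Finsupp.single (g • y) (1 : ℤ) - Finsupp.single y 1 ∈ R}
      one_mem' := fun y => by simp
      mul_mem' := fun {g h} hg hh y => by
        rw [mul_smul, ← sub_add_sub_cancel _ (Finsupp.single (h • y) (1 : ℤ)) _]
        exact add_mem (hg _) (hh _)
      inv_mem' := fun {g} hg y => by
        have := hg (g⁻¹ • y)
        rw [smul_inv_smul] at this
        rw [← neg_sub]
        exact neg_mem this }
  have hAH : A ≤ H := fun a ha y =>
    Submodule.mem_sup_left (Submodule.mem_sup_right (Submodule.subset_span ⟨a, ha, y, by simp⟩))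
  have htH : Subgroup.zpowers t ≤ H := by
    rw [Subgroup.zpowers_le]
    exact fun y => Submodule.mem_sup_right ⟨Finsupp.single y 1, by simp [Finsupp.mapDomain_single]⟩
  rintro _ ⟨a, ha, y, rfl⟩
  have := sup_le hAH htH ha y
  simpa using this

end ModTwo

section RankBound

variable {G X : Type*} [CommGroup G] [MulAction G X]

lemma chainD_mem_modTwoAug {A : Subgroup G} {k : ℕ} {c : Chain X (k + 1)}
    (hc : c ∈ modTwoAug A (Fin (k + 1) → X)) : chainD X k c ∈ modTwoAug A (Fin k → X) := by
  obtain ⟨u, j, hj, rfl⟩ := exists_of_mem_modTwoAug hc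
  rw [map_add, map_smul]
  exact add_mem (two_smul_mem_modTwoAug _) (Submodule.mem_sup_right (chainD_mem_augSub 1 hj))

/-- The complex of chains on `X`, taken modulo `2` and coinvariants under `A`, is exact at the
chains of length `k + 1`, that is `H_k(A, ℤ/2) = 0` if `k` is positive and `X` is a free `A`-set. -/
def ModTwoExactAt (X : Type*) [MulAction G X] (A : Subgroup G) (k : ℕ) : Prop :=
  ∀ y : Chain X (k + 1), chainD X k y ∈ modTwoAug A (Fin k → X) →
    y ∈ modTwoAug A (Fin (k + 1) → X) ⊔ LinearMap.range (chainD X (k + 1))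

lemma modTwoExactAt_bot [Nonempty X] (k : ℕ) : ModTwoExactAt X (⊥ : Subgroup G) (k + 1) := by
  intro y hy
  obtain ⟨u, j, hj, e⟩ := exists_of_mem_modTwoAug hy
  have hbot : augSub (1 : G →* ℤˣ) ⊥ (Fin (k + 1) → X) ≤ ⊥ := by
    refine Submodule.span_le.mpr ?_
    rintro _ ⟨a, ha, t, rfl⟩
    rw [Subgroup.mem_bot.mp ha]
    simp
  rw [(Submodule.mem_bot ℤ).mp (hbot hj), add_zero] at e
  have hu : chainD X k u = 0 := by
    have h := chainD_chainD y
    rw [e, map_smul, smul_eq_zero] at h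
    exact h.resolve_left two_ne_zero
  obtain ⟨z, rfl⟩ := exists_chainD_eq hu
  have hz : chainD X (k + 1) (y - (2 : ℤ) • z) = 0 := by rw [map_sub, map_smul, e, sub_self]
  obtain ⟨w, hw⟩ := exists_chainD_eq hz
  rw [eq_sub_iff_add_eq'] at hw
  rw [← hw]
  exact Submodule.add_mem_sup (two_smul_mem_modTwoAug _) ⟨w, rfl⟩

/-- Adjoining to `A` an element of infinite order modulo `A` raises the homological dimension by at
most one. This is the long exact sequence of `0 → Q → Q → Q/(t - 1) → 0`, where `Q` is the complex
of coinvariants under `A`. -/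
lemma ModTwoExactAt.sup_zpowers (hfree : ∀ (g : G) (x : X), g • x = x → g = 1) {A : Subgroup G}
    {t : G} (ht : ∀ m : ℤ, t ^ m ∈ A → m = 0) {k : ℕ} (h1 : ModTwoExactAt X A (k + 1))
    (h2 : ModTwoExactAt X A (k + 2)) : ModTwoExactAt X (A ⊔ Subgroup.zpowers t) (k + 2) := by
  intro y hy
  have hD : ∀ {k : ℕ} (c : Chain X (k + 1)), chainD X k (Finsupp.mapDomain (t • ·) c) =
      Finsupp.mapDomain (t • ·) (chainD X k c) := fun c => chainD_chainMap (t • · : X → X) _ c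
  obtain ⟨n, hn, _, ⟨u, rfl⟩, e⟩ := Submodule.mem_sup.mp (modTwoAug_sup_zpowers_le t hy)
  have hu : chainD X (k + 1) u ∈ modTwoAug A (Fin (k + 1) → X) := by
    refine mem_modTwoAug_of_smul_sub_mem (free_pi hfree) ht ?_
    have h := congrArg (chainD X (k + 1)) e
    rw [chainD_chainD, map_add] at h
    have h3 : chainD X (k + 1) ((Finsupp.lmapDomain ℤ ℤ (t • · : (Fin (k + 2) → X) → _) -
        LinearMap.id : Chain X (k + 2) →ₗ[ℤ] _) u) =
          Finsupp.mapDomain (t • ·) (chainD X (k + 1) u) - chainD X (k + 1) u := by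
      rw [LinearMap.sub_apply, map_sub, Finsupp.lmapDomain_apply, hD, LinearMap.id_apply]
    rw [h3] at h
    rw [eq_neg_of_add_eq_zero_right h]
    exact neg_mem (chainD_mem_modTwoAug hn)
  obtain ⟨p, hp, _, ⟨w, rfl⟩, rfl⟩ := Submodule.mem_sup.mp (h1 u hu)
  have htA : t ∈ A ⊔ Subgroup.zpowers t := Subgroup.mem_sup_right (Subgroup.mem_zpowers t)
  have hle : A ≤ A ⊔ Subgroup.zpowers t := le_sup_left
  have hy' : chainD X (k + 2) (y - (Finsupp.mapDomain (t • ·) w - w)) ∈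
      modTwoAug A (Fin (k + 2) → X) := by
    have h3 : chainD X (k + 2) (y - (Finsupp.mapDomain (t • ·) w - w)) =
        n + (Finsupp.mapDomain (t • ·) p - p) := by
      rw [map_sub, map_sub, hD, ← e, LinearMap.sub_apply, map_add, Finsupp.lmapDomain_apply,
        Finsupp.lmapDomain_apply, LinearMap.id_apply]
      abel
    rw [h3]
    exact add_mem hn (sub_mem (mapDomain_smul_mem_modTwoAug t hp) hp)
  rw [← sub_add_cancel y (Finsupp.mapDomain (t • ·) w - w)]
  exact add_mem (sup_le_sup_right (modTwoAug_mono le_sup_left) _ (h2 _ hy'))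
    (Submodule.mem_sup_left (Submodule.mem_sup_right
      (sub_mem_augSub (Subgroup.mem_sup_right (Subgroup.mem_zpowers t)) w)))

/-- `H_k(A, ℤ/2) = 0` for a free abelian group `A` of rank `r < k`. -/
lemma modTwoExactAt_closure [Nonempty X] (hfree : ∀ (g : G) (x : X), g • x = x → g = 1) {r : ℕ}
    (v : Fin r → G) (hv : LinearIndependent ℤ fun i => Additive.ofMul (v i)) (k : ℕ) :
    ModTwoExactAt X (Subgroup.closure (Set.range v)) (k + r + 1) := by
  induction r generalizing k with
  | zero =>
    rw [Set.range_eq_empty, Subgroup.closure_empty]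
    exact modTwoExactAt_bot _
  | succ r ih =>
    have ih' := ih (fun i => v i.castSucc) (hv.comp _ (Fin.castSucc_injective r))
    have hrange : Subgroup.closure (Set.range v) =
        Subgroup.closure (Set.range fun i : Fin r => v i.castSucc) ⊔
          Subgroup.zpowers (v (Fin.last r)) := by
      rw [Subgroup.zpowers_eq_closure, ← Subgroup.closure_union]
      congr 1
      ext x
      simp only [Set.mem_range, Fin.exists_fin_succ', Set.mem_union, Set.mem_singleton_iff,
        eq_comm]
    rw [hrange]
    refine ModTwoExactAt.sup_zpowers hfree (fun m hm => ?_) (ih' k) ?_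
    · refine hv.eq_zero_of_smul_mem_span (Fin.last r) m ?_
      have key : ∀ x ∈ Subgroup.closure (Set.range fun i : Fin r => v i.castSucc),
          Additive.ofMul x ∈ Submodule.span ℤ
            ((fun i => Additive.ofMul (v i)) '' (Set.univ \ {Fin.last r})) := by
        intro x hx
        induction hx using Subgroup.closure_induction with
        | mem x hx =>
          obtain ⟨i, rfl⟩ := hx
          exact Submodule.subset_span
            ⟨i.castSucc, ⟨trivial, Fin.castSucc_ne_last i⟩, rfl⟩
        | one => exact zero_mem _
        | mul x y _ _ hx hy => exact add_mem hx hy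
        | inv x _ hx => exact neg_mem hx
      exact key _ hm
    · have := ih' (k + 1)
      rwa [add_right_comm k 1 r] at this

lemma modTwoExactAt_of_free [Nonempty X] (hfree : ∀ (g : G) (x : X), g • x = x → g = 1)
    (A : Subgroup G) [Module.Free ℤ (Additive A)] [Module.Finite ℤ (Additive A)] {k : ℕ}
    (hk : Module.finrank ℤ (Additive A) < k) : ModTwoExactAt X A k := by
  let b := Module.finBasis ℤ (Additive A)
  let ι : Additive A →ₗ[ℤ] Additive G := (MonoidHom.toAdditive A.subtype).toIntLinearMap
  have hι : Function.Injective ι := A.subtype_injective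
  have hv : LinearIndependent ℤ fun i => Additive.ofMul ((b i).toMul : G) :=
    b.linearIndependent.map' ι (LinearMap.ker_eq_bot.mpr hι)
  have hA : Subgroup.closure (Set.range fun i => ((b i).toMul : G)) = A := by
    refine le_antisymm ((Subgroup.closure_le _).mpr ?_) fun a ha => ?_
    · rintro _ ⟨i, rfl⟩
      exact (b i).toMul.2
    · have h : (Additive.ofMul (⟨a, ha⟩ : A)) ∈ Submodule.span ℤ (Set.range b) := by
        rw [b.span_eq]
        trivial
      have key : ∀ x ∈ Submodule.span ℤ (Set.range b), (x.toMul : G) ∈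
          Subgroup.closure (Set.range fun i => ((b i).toMul : G)) := by
        intro x hx
        induction hx using Submodule.span_induction with
        | mem x hx =>
          obtain ⟨i, rfl⟩ := hx
          exact Subgroup.subset_closure ⟨i, rfl⟩
        | zero => exact one_mem _
        | add x y _ _ hx hy => exact mul_mem hx hy
        | smul m x _ hx => exact zpow_mem hx m
      exact key _ h
  have := modTwoExactAt_closure hfree (fun i => ((b i).toMul : G)) hv
    (k - 1 - Module.finrank ℤ (Additive A))
  rw [hA] at this
  convert this using 1
  omega

/-- The homology of a free abelian group of rank at most `m`, with coefficients twisted by a sign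
character, has no `2`-torsion in degree `m`: a `2`-torsion class comes from homology modulo `2` in
degree `m + 1`, which vanishes. -/
lemma mem_of_two_smul_mem [Nonempty X] (hfree : ∀ (g : G) (x : X), g • x = x → g = 1)
    (χ : G →* ℤˣ) (A : Subgroup G) [Module.Free ℤ (Additive A)] [Module.Finite ℤ (Additive A)]
    {m : ℕ} (hm : Module.finrank ℤ (Additive A) ≤ m) {c : Chain X (m + 1)}
    (hc : (2 : ℤ) • c ∈ augSub χ A (Fin (m + 1) → X) ⊔ LinearMap.range (chainD X (m + 1))) :
    c ∈ augSub χ A (Fin (m + 1) → X) ⊔ LinearMap.range (chainD X (m + 1)) := by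
  obtain ⟨j, hj, _, ⟨z, rfl⟩, e⟩ := Submodule.mem_sup.mp hc
  have hz : chainD X (m + 1) z ∈ modTwoAug A (Fin (m + 1) → X) := by
    rw [eq_sub_of_add_eq' e]
    exact sub_mem (two_smul_mem_modTwoAug c) (augSub_le_two_sup χ 1 hj)
  obtain ⟨n, hn, _, ⟨w, rfl⟩, rfl⟩ :=
    Submodule.mem_sup.mp (modTwoExactAt_of_free hfree A (Nat.lt_succ_of_le hm) z hz)
  obtain ⟨x, i, hi, rfl⟩ := exists_of_mem_modTwoAug hn
  obtain ⟨_, ⟨x', rfl⟩, i', hi', rfl⟩ := Submodule.mem_sup.mp (augSub_le_two_sup 1 χ hi)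
  rw [map_add, chainD_chainD, add_zero] at e
  have h : (2 : ℤ) • (c - chainD X (m + 1) (x + x')) ∈ augSub χ A (Fin (m + 1) → X) := by
    have h1 : (2 : ℤ) • (c - chainD X (m + 1) (x + x')) = j + chainD X (m + 1) i' := by
      rw [smul_sub, ← e, LinearMap.smul_apply, LinearMap.id_apply]
      simp only [map_add, map_smul, smul_add]
      abel
    rw [h1]
    exact add_mem hj (chainD_mem_augSub χ hi')
  rw [← sub_add_cancel c (chainD X (m + 1) (x + x'))]
  exact Submodule.add_mem_sup (mem_augSub_of_two_smul_mem χ (free_pi hfree) h) ⟨_, rfl⟩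

end RankBound

/-! ### Signs, units and elements prime to `T` -/

section Signs

variable {F : Type*} [Field F] [NumberField F] [IsTotallyReal F]

/-- The real embedding of `F` attached to an infinite place. -/
def realEmb (w : InfinitePlace F) : F →+* ℝ :=
  InfinitePlace.embedding_of_isReal (IsTotallyReal.isReal w)

lemma coe_signAt (w : InfinitePlace F) (x : Fˣ) :
    ((signAt w x : ℤˣ) : ℤ) = ((SignType.sign (realEmb w x) : SignType) : ℤ) :=
  rfl

lemma signAt_eq_one_iff (w : InfinitePlace F) (x : Fˣ) : signAt w x = 1 ↔ 0 < realEmb w x := by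
  rw [Units.ext_iff, coe_signAt, Units.val_one, ← sign_eq_one_iff]
  generalize SignType.sign (realEmb w x) = s
  revert s
  decide

lemma signAt_eq_neg_one_iff (w : InfinitePlace F) (x : Fˣ) :
    signAt w x = -1 ↔ realEmb w x < 0 := by
  rw [Units.ext_iff, coe_signAt, Units.val_neg, Units.val_one, ← sign_eq_neg_one_iff]
  generalize SignType.sign (realEmb w x) = s
  revert s
  decide

lemma realEmb_injective (w : InfinitePlace F) : Function.Injective (realEmb w) :=
  (realEmb w).injective

lemma sgn_apply (x : Fˣ) : sgn x = ∏ w : InfinitePlace F, signAt w x := by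
  rw [sgn, MonoidHom.finsetProd_apply]

lemma signs_eq_one_iff {W : Finset (InfinitePlace F)} {x : Fˣ} :
    signs W x = 1 ↔ ∀ w ∈ W, signAt w x = 1 :=
  ⟨fun h w hw => congrFun h ⟨w, hw⟩, fun h => funext fun w => h w.1 w.2⟩

lemma mem_totallyPositive_iff {x : Fˣ} :
    x ∈ totallyPositive F ↔ ∀ w : InfinitePlace F, signAt w x = 1 := by
  rw [totallyPositive, MonoidHom.mem_ker, signs_eq_one_iff]
  exact ⟨fun h w => h w (Finset.mem_univ w), fun h w _ => h w⟩

lemma sgn_eq_one_of_totallyPositive {x : Fˣ} (hx : x ∈ totallyPositive F) : sgn x = 1 := by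
  rw [sgn_apply]
  exact Finset.prod_eq_one fun w _ => mem_totallyPositive_iff.mp hx w

/-- Weak approximation at the infinite places. -/
lemma exists_integer_with_signs (v : InfinitePlace F) :
    ∃ z : 𝓞 F, realEmb v (z : F) < 0 ∧ ∀ w ≠ v, 0 < realEmb w (z : F) := by
  classical
  obtain ⟨y, hy⟩ := (InfinitePlace.denseRange_algebraMap_pi F).exists_dist_lt
    (fun w => WithAbs.toAbs w.1 (if w = v then (-1 : F) else 1)) one_pos
  rw [dist_pi_lt_iff one_pos] at hy
  have hy' : ∀ w : InfinitePlace F, |realEmb w ((if w = v then (-1 : F) else 1) - y)| < 1 := by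
    intro w
    have h := hy w
    rw [dist_eq_norm] at h
    rw [← Real.norm_eq_abs]
    refine lt_of_eq_of_lt (InfinitePlace.norm_embedding_of_isReal _ _) ?_
    exact h
  obtain ⟨a, b, hb, rfl⟩ := IsFractionRing.div_surjective (A := 𝓞 F) y
  have hb0 : algebraMap (𝓞 F) F b ≠ 0 :=
    (map_ne_zero_iff _ (FaithfulSMul.algebraMap_injective (𝓞 F) F)).mpr (nonZeroDivisors.ne_zero hb)
  have key : ∀ w : InfinitePlace F, realEmb w ((a * b : 𝓞 F) : F) =
      realEmb w (algebraMap (𝓞 F) F a / algebraMap (𝓞 F) F b) * realEmb w (algebraMap (𝓞 F) F b) ^ 2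
      := by
    intro w
    rw [← map_pow, ← map_mul]
    congr 1
    change algebraMap (𝓞 F) F (a * b) = _
    rw [map_mul]
    field_simp
  have hpos : ∀ w : InfinitePlace F, 0 < realEmb w (algebraMap (𝓞 F) F b) ^ 2 := fun w =>
    sq_pos_of_ne_zero ((map_ne_zero_iff _ (realEmb_injective w)).mpr hb0)
  refine ⟨a * b, ?_, fun w hw => ?_⟩
  · have h := hy' v
    rw [if_pos rfl, map_sub, map_neg, map_one, abs_lt] at h
    rw [key]
    exact mul_neg_of_neg_of_pos (by linarith) (hpos v)
  · have h := hy' w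
    rw [if_neg hw, map_sub, map_one, abs_lt] at h
    rw [key]
    exact mul_pos (by linarith) (hpos w)

lemma residueChar_mem (p : HeightOneSpectrum (𝓞 F)) : (residueChar p : 𝓞 F) ∈ p.asIdeal := by
  rw [← Ideal.Quotient.eq_zero_iff_mem, map_natCast]
  exact ringChar.Nat.cast_ringChar

lemma residueChar_pos (p : HeightOneSpectrum (𝓞 F)) : 0 < residueChar p := by
  have : Finite (𝓞 F ⧸ p.asIdeal) := Ideal.finiteQuotientOfFreeOfNeBot p.asIdeal p.ne_bot
  exact Nat.pos_of_ne_zero (CharP.ringChar_ne_zero_of_finite _)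

/-- There is an element prime to `T` that is negative at `v` and positive at all other infinite
places: if `z` is an algebraic integer with these signs, then `1 + k z` will do for a large multiple
`k` of the residue characteristics of `T`. -/
lemma exists_signAt_eq_neg_one (T : Finset (Place F)) (v : InfinitePlace F) :
    ∃ x ∈ unitsPrimeTo T, signAt v x = -1 ∧ ∀ w ≠ v, signAt w x = 1 := by
  obtain ⟨z, hzv, hz⟩ := exists_integer_with_signs v
  set M : ℕ := ∏ q ∈ T.toRight, residueChar q with hM
  have hM0 : 0 < M := Finset.prod_pos fun q _ => residueChar_pos q
  obtain ⟨N, hN⟩ := exists_nat_gt (-(realEmb v (z : F)))⁻¹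
  have hkN : (N : ℝ) ≤ ((M * N : ℕ) : ℝ) := by
    exact_mod_cast Nat.le_mul_of_pos_left N hM0
  set k : ℕ := M * N
  set y : 𝓞 F := 1 + k * z with hy
  have hyw : ∀ w : InfinitePlace F, realEmb w (y : F) = 1 + k * realEmb w (z : F) := fun w => by
    simp [hy]
  have hyv : realEmb v (y : F) < 0 := by
    rw [hyw]
    have h1 : 0 < -(realEmb v (z : F)) := neg_pos.mpr hzv
    have h2 : (-(realEmb v (z : F)))⁻¹ < k := hN.trans_le hkN
    rw [inv_lt_iff_one_lt_mul₀ h1] at h2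
    linarith
  have hy0 : (y : F) ≠ 0 := fun h => by
    rw [h, map_zero] at hyv
    exact lt_irrefl _ hyv
  refine ⟨Units.mk0 (y : F) hy0, ?_, (signAt_eq_neg_one_iff _ _).mpr hyv, fun w hw =>
    (signAt_eq_one_iff _ _).mpr ?_⟩
  · rintro p ⟨q, hq, hpq⟩
    have hyp : y ∉ p.asIdeal := by
      intro hmem
      have hkp : (k : 𝓞 F) ∈ p.asIdeal := by
        have hd : residueChar p ∣ k := by
          rw [hpq]
          exact (Finset.dvd_prod_of_mem residueChar hq).mul_right N
        obtain ⟨c, hc⟩ := hd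
        rw [hc, Nat.cast_mul]
        exact Ideal.mul_mem_right _ _ (residueChar_mem p)
      have h1 : (1 : 𝓞 F) ∈ p.asIdeal := by
        have := sub_mem hmem (Ideal.mul_mem_right z _ hkp)
        rwa [hy, add_sub_cancel_right] at this
      exact p.isPrime.ne_top ((Ideal.eq_top_iff_one _).mpr h1)
    have hval : p.valuation F ((Units.mk0 (y : F) hy0 : Fˣ) : F) = 1 :=
      p.valuation_eq_one_iff_notMem.mpr hyp
    rw [valuation_eq_exp_neg_count, WithZero.exp_eq_one, neg_eq_zero] at hval
    exact hval
  · change 0 < realEmb w (y : F)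
    rw [hyw]
    have := mul_nonneg (Nat.cast_nonneg (α := ℝ) k) (hz w hw).le
    linarith

lemma principal_eq_one_iff {x : Fˣ} :
    principal F x = 1 ↔ x ∈ (Units.map (algebraMap (𝓞 F) F).toMonoidHom).range := by
  have hmem : ∀ y : Fˣ, principal F y = 1 → ∃ a : 𝓞 F, algebraMap (𝓞 F) F a = y := by
    intro y hy
    have h := congrArg Units.val hy
    rw [coe_toPrincipalIdeal, Units.val_one] at h
    rw [← FractionalIdeal.mem_one_iff (𝓞 F)⁰, ← h]
    exact FractionalIdeal.mem_spanSingleton_self _ _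
  constructor
  · intro hx
    obtain ⟨a, ha⟩ := hmem x hx
    obtain ⟨b, hb⟩ := hmem x⁻¹ (by rw [map_inv, hx, inv_one])
    have hab : a * b = 1 := by
      refine FaithfulSMul.algebraMap_injective (𝓞 F) F ?_
      rw [map_mul, ha, hb, map_one, Units.mul_inv]
    exact ⟨⟨a, b, hab, by rw [mul_comm, hab]⟩, Units.ext ha⟩
  · rintro ⟨u, rfl⟩
    refine Units.ext ?_
    rw [coe_toPrincipalIdeal, Units.val_one]
    change FractionalIdeal.spanSingleton (𝓞 F)⁰ (algebraMap (𝓞 F) F u) = 1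
    rw [← FractionalIdeal.coeIdeal_span_singleton, Ideal.span_singleton_eq_top.mpr u.isUnit,
      FractionalIdeal.coeIdeal_top]

end Signs

/-! ### The rank of the group of units positive at given places -/

section PositiveUnits

variable {F : Type*} [Field F] [NumberField F] [IsTotallyReal F]

/-- The group of elements of `F_(T)` that are positive at the places in `W`. It acts by
multiplication on the set `F_{g}` with `g = 1` in `X_W`, which is a copy of the group itself. -/
def posOn (T : Finset (Place F)) (W : Finset (InfinitePlace F)) : Subgroup (unitsPrimeTo T) :=
  ((signs W).comp (unitsPrimeTo T).subtype).ker

variable {T : Finset (Place F)} {W : Finset (InfinitePlace F)}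

instance instMulActionPosOn : MulAction (posOn T W) (SignClass T (1 : SignGroup W)) where
  smul h x := ⟨h.1 * x.1, by
    have h1 : signs W h.1.1 = 1 := h.2
    rw [Subgroup.coe_mul, map_mul, h1, x.2, one_mul]⟩
  one_smul x := Subtype.ext (one_mul x.1)
  mul_smul h k x := Subtype.ext (mul_assoc h.1 k.1 x.1)

instance : Nonempty (SignClass T (1 : SignGroup W)) := ⟨⟨1, map_one _⟩⟩

lemma posOn_free (h : posOn T W) (x : SignClass T (1 : SignGroup W)) (hx : h • x = x) : h = 1 := by
  have h1 : h.1 * x.1 = x.1 := congrArg Subtype.val hx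
  exact Subtype.ext (mul_eq_right.mp h1)

variable (T W) in
/-- The units of `𝓞 F` that are positive at the places in `W`. -/
def unitsOn : Subgroup (posOn T W) :=
  (Units.map (algebraMap (𝓞 F) F).toMonoidHom).range.comap
    ((unitsPrimeTo T).subtype.comp (posOn T W).subtype)

variable (T W) in
/-- The sign character of `F_(T)`, restricted to the elements that are positive on `W`. -/
def sgnOn : posOn T W →* ℤˣ := sgn.comp ((unitsPrimeTo T).subtype.comp (posOn T W).subtype)

/-- If `W` is nonempty, then a unit that is positive on `W` and of finite order is `1`; hence the
logarithmic embedding maps the units positive on `W` injectively to the unit lattice, which is free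
of rank `[F : ℚ] - 1`. -/
lemma exists_injective_unitsOn (hW : W.Nonempty) :
    ∃ f : Additive (unitsOn T W) →ₗ[ℤ] NumberField.Units.unitLattice F, Function.Injective f := by
  have hinj : Function.Injective (Units.map (algebraMap (𝓞 F) F).toMonoidHom) :=
    Units.map_injective (FaithfulSMul.algebraMap_injective (𝓞 F) F)
  let e := (MonoidHom.ofInjective hinj).symm
  let g : unitsOn T W →* (Units.map (algebraMap (𝓞 F) F).toMonoidHom).range :=
    { toFun := fun u => ⟨u.1.1.1, u.2⟩
      map_one' := rfl
      map_mul' := fun _ _ => rfl }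
  let f₀ := (NumberField.Units.logEmbedding F).comp (MonoidHom.toAdditive (e.toMonoidHom.comp g))
  let f : Additive (unitsOn T W) →+ NumberField.Units.unitLattice F :=
    f₀.codRestrict (NumberField.Units.unitLattice F) fun u => ⟨_, trivial, rfl⟩
  refine ⟨f.toIntLinearMap, (injective_iff_map_eq_zero f).mpr fun u hu => ?_⟩
  obtain ⟨w, hw⟩ := hW
  have h1 : e (g u.toMul) ∈ NumberField.Units.torsion F :=
    NumberField.Units.dirichletUnitTheorem.logEmbedding_eq_zero_iff.mp (congrArg Subtype.val hu)
  obtain ⟨n, hn, h2⟩ := isOfFinOrder_iff_pow_eq_one.mp ((CommGroup.mem_torsion _).mp h1)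
  have h3 : (u.toMul.1.1.1 : Fˣ) ^ n = 1 := by
    have h4 : e (g u.toMul ^ n) = 1 := by rw [map_pow, h2]
    rw [map_eq_one_iff e e.injective] at h4
    exact congrArg Subtype.val h4
  have h5 : 0 < realEmb w (u.toMul.1.1.1 : F) :=
    (signAt_eq_one_iff w _).mp (signs_eq_one_iff.mp u.toMul.1.2 w hw)
  have h6 : realEmb w (u.toMul.1.1.1 : F) ^ n = 1 := by
    rw [← map_pow, ← Units.val_pow_eq_pow_val, h3, Units.val_one, map_one]
  have h7 : realEmb w (u.toMul.1.1.1 : F) = 1 :=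
    (pow_eq_one_iff_of_nonneg h5.le hn.ne').mp h6
  have h8 : u.toMul = 1 := by
    refine Subtype.ext (Subtype.ext (Subtype.ext (Units.ext (realEmb_injective w ?_))))
    rw [h7]
    exact (map_one _).symm
  exact h8

lemma free_unitsOn (hW : W.Nonempty) : Module.Free ℤ (Additive (unitsOn T W)) := by
  obtain ⟨f, hf⟩ := exists_injective_unitsOn (T := T) hW
  have := Module.Free.of_basis (NumberField.Units.basisUnitLattice F)
  have := Module.Finite.of_basis (NumberField.Units.basisUnitLattice F)
  exact Module.Free.of_equiv (LinearEquiv.ofInjective f hf).symm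

lemma finite_unitsOn (hW : W.Nonempty) : Module.Finite ℤ (Additive (unitsOn T W)) := by
  obtain ⟨f, hf⟩ := exists_injective_unitsOn (T := T) hW
  have := Module.Free.of_basis (NumberField.Units.basisUnitLattice F)
  have := Module.Finite.of_basis (NumberField.Units.basisUnitLattice F)
  exact Module.Finite.of_injective f hf

lemma finrank_unitsOn_le (hW : W.Nonempty) :
    Module.finrank ℤ (Additive (unitsOn T W)) ≤ Module.finrank ℚ F - 1 := by
  obtain ⟨f, hf⟩ := exists_injective_unitsOn (T := T) hW
  have := Module.Finite.of_basis (NumberField.Units.basisUnitLattice F)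
  refine (LinearMap.finrank_le_finrank_of_injective hf).trans ?_
  rw [NumberField.Units.unitLattice_rank, NumberField.Units.rank, InfinitePlace.card_eq_nrRealPlaces_add_nrComplexPlaces,
    IsTotallyReal.nrComplexPlaces_eq_zero, add_zero, ← IsTotallyReal.finrank]

end PositiveUnits

/-! ### Cycles for the group of totally positive units -/

section Cycles

variable {F : Type*} [Field F] [NumberField F] [IsTotallyReal F]
variable {T : Finset (Place F)} {W : Finset (InfinitePlace F)}

variable (T W) in
/-- The inclusion of `E_+` in the group of elements of `F_(T)` that are positive on `W`. -/
def posUnitsHom : posUnits F →* posOn T W where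
  toFun e := ⟨⟨e.1, by
      change principal F e.1 ∈ idealsPrimeTo T
      rw [principal_eq_one_iff.mpr e.2.1]
      exact one_mem _⟩,
    signs_eq_one_iff.mpr fun w _ => mem_totallyPositive_iff.mp e.2.2 w⟩
  map_one' := rfl
  map_mul' _ _ := rfl

lemma range_posUnitsHom_le : (posUnitsHom T W).range ≤ unitsOn T W := by
  rintro _ ⟨e, rfl⟩
  exact e.2.1

lemma sgnOn_posUnitsHom (e : posUnits F) : sgnOn T W (posUnitsHom T W e) = 1 :=
  sgn_eq_one_of_totallyPositive e.2.2

variable (T W) in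
/-- The chains whose class in the coinvariants under `E_+` is a boundary. -/
def trivialChains (k : ℕ) : Submodule ℤ (Chain (SignClass T (1 : SignGroup W)) (k + 1)) :=
  augSub 1 (posUnitsHom T W).range (Fin (k + 1) → SignClass T (1 : SignGroup W)) ⊔
    LinearMap.range (chainD (SignClass T (1 : SignGroup W)) (k + 1))

/-- A chain on the elements positive on `W` that becomes a cycle in the coinvariants under `E_+`. For
`k = 0` there is no condition, since the augmentation term `C_0` is not part of the resolution. -/
def IsCycleOn {k : ℕ} (c : Chain (SignClass T (1 : SignGroup W)) (k + 1)) : Prop :=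
  k ≠ 0 → chainD _ k c ∈
    augSub 1 (posUnitsHom T W).range (Fin k → SignClass T (1 : SignGroup W))

variable (T W) in
/-- The elements of `F_(T)` that are positive on `W` form an `E_+`-equivariant retract of `Fˣ`, so
that the homology of `E_+` may be computed by chains on them. -/
lemma exists_retraction_units :
    ∃ σ : Fˣ → SignClass T (1 : SignGroup W),
      (∀ (e : posUnits F) (y : Fˣ), σ (e • y) = posUnitsHom T W e • σ y) ∧ ∀ x, σ x.1.1 = x := by
  let : MulAction (posUnits F) (SignClass T (1 : SignGroup W)) :=
    MulAction.compHom _ (posUnitsHom T W)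
  exact exists_equivariant_retraction (E := posUnits F)
    (fun e y h => Subtype.ext (mul_eq_right.mp h))
    (fun x : SignClass T (1 : SignGroup W) => (x.1.1 : Fˣ))
    (fun x y h => Subtype.ext (Subtype.ext h)) (fun _ _ => rfl)

lemma chainMap_mem_of_mem_ker {σ : Fˣ → SignClass T (1 : SignGroup W)}
    (hσ : ∀ (e : posUnits F) (y : Fˣ), σ (e • y) = posUnitsHom T W e • σ y) {k : ℕ}
    {c : Chain Fˣ k}
    (hc : c ∈ Representation.Coinvariants.ker (permRep (posUnits F) (Fin k → Fˣ))) :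
    chainMap σ k c ∈ augSub 1 (posUnitsHom T W).range (Fin k → SignClass T (1 : SignGroup W)) := by
  refine (Submodule.span_le (p := (augSub 1 (posUnitsHom T W).range
    (Fin k → SignClass T (1 : SignGroup W))).comap (chainMap σ k))).mpr ?_ hc
  rintro _ ⟨⟨e, c⟩, rfl⟩
  rw [SetLike.mem_coe, Submodule.mem_comap, map_sub]
  have h : chainMap σ k (permRep (posUnits F) (Fin k → Fˣ) e c) =
      Finsupp.mapDomain (posUnitsHom T W e • ·) (chainMap σ k c) := by
    change Finsupp.mapDomain _ (Finsupp.mapDomain _ c) =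
      Finsupp.mapDomain _ (Finsupp.mapDomain _ c)
    rw [← Finsupp.mapDomain_comp, ← Finsupp.mapDomain_comp]
    congr 1
    funext t
    exact funext fun i => hσ e (t i)
  rw [h]
  exact sub_mem_augSub (MonoidHom.mem_range.mpr ⟨e, rfl⟩) _

/-- The inclusion of the elements positive on `U` in the elements positive on `W`, for `W ⊆ U`. -/
def SignClass.res {U : Finset (InfinitePlace F)} (h : W ⊆ U)
    (x : SignClass T (1 : SignGroup U)) : SignClass T (1 : SignGroup W) :=
  ⟨x.1, signs_eq_one_iff.mpr fun w hw => signs_eq_one_iff.mp x.2 w (h hw)⟩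

variable {U : Finset (InfinitePlace F)} (hWU : W ⊆ U) {η : HomologyOf (posUnits F)}

lemma chainMap_retraction {σ : Fˣ → SignClass T (1 : SignGroup W)} (hσ : ∀ x, σ x.1.1 = x) {k : ℕ}
    (c : Chain (SignClass T (1 : SignGroup U)) k) :
    chainMap σ k (chainMap (fun x : SignClass T (1 : SignGroup U) => (x.1 : Fˣ)) k c) =
      chainMap (SignClass.res hWU) k c := by
  change Finsupp.mapDomain _ (Finsupp.mapDomain _ c) = Finsupp.mapDomain _ c
  rw [← Finsupp.mapDomain_comp]
  congr 1
  funext t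
  exact funext fun i => hσ (SignClass.res hWU (t i))

/-- Being a cycle modulo `E_+` can be tested in `Fˣ`, since there is an equivariant retraction. -/
lemma isCycleOn_of_mem {D : ConeMod F (SignClass T (1 : SignGroup U))}
    (hD : chainModMap (fun x : SignClass T (1 : SignGroup U) => (x.1 : Fˣ)) _ D ∈ cyclesInClass η)
    {c : Chain (SignClass T (1 : SignGroup W)) (Module.finrank ℚ F - 1 + 1)}
    (hc : Submodule.mkQ _ c = chainModMap (SignClass.res hWU) _ D) : IsCycleOn c := by
  intro hn
  obtain ⟨σ, hσ, hσ'⟩ := exists_retraction_units T W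
  obtain ⟨d, rfl⟩ := Submodule.mkQ_surjective _ D
  obtain ⟨h1, -⟩ := hD
  have h2 := chainMap_mem_of_mem_ker hσ (h1 (by omega))
  change chainMap σ _ (chainD Fˣ _ (chainMap _ _ d)) ∈ _ at h2
  rw [← chainD_chainMap, chainMap_retraction hWU hσ'] at h2
  have h3 : c - chainMap (SignClass.res hWU) _ d ∈ LinearMap.ker (chainD _ _) :=
    (Submodule.Quotient.eq _).mp hc
  rw [LinearMap.mem_ker, map_sub, sub_eq_zero] at h3
  rwa [h3]

/-- Two cycles in the same homology class differ by a trivial chain. -/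
lemma sub_mem_trivialChains {D D' : ConeMod F (SignClass T (1 : SignGroup U))}
    (hD : chainModMap (fun x : SignClass T (1 : SignGroup U) => (x.1 : Fˣ)) _ D ∈ cyclesInClass η)
    (hD' : chainModMap (fun x : SignClass T (1 : SignGroup U) => (x.1 : Fˣ)) _ D' ∈ cyclesInClass η)
    {c c' : Chain (SignClass T (1 : SignGroup W)) (Module.finrank ℚ F - 1 + 1)}
    (hc : Submodule.mkQ _ c = chainModMap (SignClass.res hWU) _ D)
    (hc' : Submodule.mkQ _ c' = chainModMap (SignClass.res hWU) _ D') :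
    c - c' ∈ trivialChains T W _ := by
  obtain ⟨σ, hσ, hσ'⟩ := exists_retraction_units T W
  obtain ⟨d, rfl⟩ := Submodule.mkQ_surjective _ D
  obtain ⟨d', rfl⟩ := Submodule.mkQ_surjective _ D'
  obtain ⟨h1, h2⟩ := hD
  obtain ⟨h1', h2'⟩ := hD'
  obtain ⟨b, hb, hb'⟩ := (Submodule.Quotient.eq _).mp (h2.trans h2'.symm)
  have h3 : b - chainMap (fun x : SignClass T (1 : SignGroup U) => (x.1 : Fˣ)) _ (d - d') ∈
      LinearMap.ker (chainD _ _) := by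
    refine (Submodule.Quotient.eq _).mp ?_
    rw [map_sub]
    exact hb'
  have h4 : chainMap σ _ b - chainMap (SignClass.res hWU) _ (d - d') ∈
      LinearMap.ker (chainD _ _) := by
    rw [← chainMap_retraction hWU hσ', ← map_sub, LinearMap.mem_ker, chainD_chainMap,
      LinearMap.mem_ker.mp h3, map_zero]
  have h5 : c - chainMap (SignClass.res hWU) _ d ∈ LinearMap.ker (chainD _ _) :=
    (Submodule.Quotient.eq _).mp hc
  have h5' : c' - chainMap (SignClass.res hWU) _ d' ∈ LinearMap.ker (chainD _ _) :=
    (Submodule.Quotient.eq _).mp hc'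
  have h6 := sub_mem (sub_mem h5 h5') h4
  have h7 : c - c' = chainMap σ _ b + (c - chainMap (SignClass.res hWU) _ d -
      (c' - chainMap (SignClass.res hWU) _ d') -
        (chainMap σ _ b - chainMap (SignClass.res hWU) _ (d - d'))) := by
    rw [map_sub]
    abel
  rw [h7]
  rw [ker_chainD] at h6
  exact Submodule.add_mem_sup (chainMap_mem_of_mem_ker hσ hb) h6

end Cycles

/-! ### Classes in the coinvariants of `B(W)` -/

section Classes

variable {F : Type*} [Field F] [NumberField F] [IsTotallyReal F] (S T V W : Finset (Place F))

/-- The class of `m ⊗ s ⊗ 1` in `B(W) / I B(W)`, as a linear function of `m`. -/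
def tensorClass (s : NS S) : MMod S T V W →ₗ[ℤ] (repB S T V W).Coinvariants :=
  Representation.Coinvariants.mk (repB S T V W) ∘ₗ Induced.mk _ _ _ ∘ₗ
    (TensorProduct.mk ℤ _ _).flip 1 ∘ₗ (TensorProduct.mk ℤ _ _).flip (MonoidAlgebra.single s 1)

lemma tensorClass_apply (s : NS S) (m : MMod S T V W) :
    tensorClass S T V W s m = Representation.Coinvariants.mk (repB S T V W)
      (Induced.mk _ _ _ ((m ⊗ₜ[ℤ] MonoidAlgebra.single s (1 : ℤ)) ⊗ₜ[ℤ] (1 : MonoidAlgebra ℤ Fˣ))) :=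
  rfl

/-- The defining relation of `B(W)` in the coinvariants: with `c = 1`, multiplying the last tensor
factor by `x` does not change the class. -/
lemma tensorClass_repM (x : unitsPrimeTo T) (s : NS S) (m : MMod S T V W) :
    tensorClass S T V W s (repM S T V W x m) = tensorClass S T V W (iS S x.1 * s) m := by
  rw [tensorClass_apply, tensorClass_apply]
  have h1 := (Submodule.Quotient.eq (inducedRel (repM S T V W)
    ((iS S).comp (unitsPrimeTo T).subtype) (unitsPrimeTo T).subtype)).mpr
      (Submodule.subset_span ⟨x, repM S T V W x m, MonoidAlgebra.single s 1, 1, rfl⟩)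
  rw [← Module.End.mul_apply, ← map_mul, inv_mul_cancel, map_one, Module.End.one_apply,
    MonoidAlgebra.single_mul_single, one_mul] at h1
  have h2 : Induced.mk (repM S T V W) ((iS S).comp (unitsPrimeTo T).subtype)
      (unitsPrimeTo T).subtype ((repM S T V W x m ⊗ₜ[ℤ] MonoidAlgebra.single s (1 : ℤ)) ⊗ₜ[ℤ]
        (MonoidAlgebra.single x.1 (1 : ℤ) * 1)) = repB S T V W x.1
      (Induced.mk _ _ _ ((repM S T V W x m ⊗ₜ[ℤ] MonoidAlgebra.single s (1 : ℤ)) ⊗ₜ[ℤ]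
        (1 : MonoidAlgebra ℤ Fˣ))) := rfl
  rw [← Representation.Coinvariants.mk_self_apply (repB S T V W) x.1, ← h2]
  exact congrArg _ h1.symm

end Classes

/-! ### The terms of `ϑ` as functions of the ideal and the chain -/

section Theta

variable {F : Type*} [Field F] [NumberField F] [IsTotallyReal F] (S T V W : Finset (Place F))

/-- The set `F_1` for the set of infinite places in `W̄`. -/
abbrev BarClass : Type _ := SignClass T (1 : SignGroup (bar S V W).toLeft)

/-- The element `𝔞⁻¹ ∏_{p ∈ W̄ ∩ S_f} (1 - [p]) ∏_{p ∈ T} (1 - N(p)[p])` of `𝒜_{W̄ ∩ S_f}`. -/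
def deltaElt (I : idealsPrimeTo T) : AMod T (bar S V W).toRight :=
  ⟨MonoidAlgebra.single (I⁻¹).1 (1 : ℤ) * delta T (bar S V W).toRight,
    single_mul_delta_mem _ (I⁻¹).2⟩

/-- The class of `(c⟦1⟧ ⊗ 𝔞⁻¹ δ) ⊗ ι(𝔞) ⊗ 1` in `B(W) / I B(W)`, for a chain `c`. -/
def thetaOn (I : idealsPrimeTo T) :
    Chain (BarClass S T V W) (Module.finrank ℚ F - 1 + 1) →ₗ[ℤ] (repB S T V W).Coinvariants :=
  tensorClass S T V W (iota S I.1) ∘ₗ (TensorProduct.mk ℤ _ _).flip (deltaElt S T V W I) ∘ₗ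
    bracket T 1 ∘ₗ Submodule.mkQ _

lemma thetaOn_apply (I : idealsPrimeTo T)
    (c : Chain (BarClass S T V W) (Module.finrank ℚ F - 1 + 1)) :
    thetaOn S T V W I c = tensorClass S T V W (iota S I.1)
      (bracket T 1 (Submodule.mkQ _ c) ⊗ₜ[ℤ] deltaElt S T V W I) :=
  rfl

variable {S T V W}

lemma repK_bracket {U : Finset (InfinitePlace F)} (h : posOn T U)
    (c : Chain (SignClass T (1 : SignGroup U)) (Module.finrank ℚ F - 1 + 1)) :
    repK T U h.1 (bracket T 1 (Submodule.mkQ _ c)) =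
      ((sgnOn T U h : ℤˣ) : ℤ) • bracket T 1 (Submodule.mkQ _ (chainMap (h • ·) _ c)) := by
  rw [← map_smul, ← map_smul]
  change KMod.mk T U (((sgnOn T U h : ℤˣ) : ℤ) • Finsupp.mapDomain _ (Finsupp.mapDomain _ c)) =
    KMod.mk T U (Finsupp.mapDomain _ (((sgnOn T U h : ℤˣ) : ℤ) • Finsupp.mapDomain _ c))
  rw [Finsupp.mapDomain_smul, ← Finsupp.mapDomain_comp, ← Finsupp.mapDomain_comp]
  congr 3
  funext t
  refine Subtype.ext (Prod.ext ?_ rfl)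
  change signs U h.1.1 * 1 = 1
  rw [mul_one]
  exact h.2

/-- The principal ideal generated by an element of `F_(T)`. -/
def principalPrimeTo (T : Finset (Place F)) (x : unitsPrimeTo T) : idealsPrimeTo T :=
  ⟨principal F x.1, x.2⟩

lemma repA_deltaElt (x : unitsPrimeTo T) (I : idealsPrimeTo T) :
    repA T (bar S V W).toRight x (deltaElt S T V W (principalPrimeTo T x * I)) =
      deltaElt S T V W I := by
  refine Subtype.ext ?_
  rw [repA_coe]
  change _ * (MonoidAlgebra.single ((principal F x.1 * I.1)⁻¹) 1 * _) =
    MonoidAlgebra.single (I.1⁻¹) 1 * _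
  rw [← mul_assoc, MonoidAlgebra.single_mul_single, mul_one, mul_inv, mul_inv_cancel_left]

/-- The relation `[x m, s] = [m, i^S(x) s]`, applied to `m = c⟦1⟧ ⊗ (x 𝔞)⁻¹ δ` and `s = ι(𝔞)`. -/
lemma thetaOn_principal_mul (h : posOn T (bar S V W).toLeft) (I : idealsPrimeTo T)
    (c : Chain (BarClass S T V W) (Module.finrank ℚ F - 1 + 1)) :
    thetaOn S T V W (principalPrimeTo T h.1 * I) c =
      ((sgnOn T _ h : ℤˣ) : ℤ) • thetaOn S T V W I (chainMap (h • ·) _ c) := by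
  have h1 : iota S (principalPrimeTo T h.1 * I).1 = iS S h.1.1 * iota S I.1 := by
    rw [← iota_principal, ← map_mul]
    rfl
  rw [thetaOn_apply, h1, ← tensorClass_repM, thetaOn_apply, ← map_smul,
    TensorProduct.smul_tmul', ← repK_bracket]
  congr 1
  rw [← repA_deltaElt h.1 I]
  rfl

lemma augSub_le_ker_thetaOn (I : idealsPrimeTo T) :
    augSub (sgnOn T _) (unitsOn T (bar S V W).toLeft) (Fin _ → BarClass S T V W) ≤
      LinearMap.ker (thetaOn S T V W I) := by
  refine Submodule.span_le.mpr ?_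
  rintro _ ⟨e, he, t, rfl⟩
  have h1 : principalPrimeTo T e.1 = 1 := Subtype.ext (principal_eq_one_iff.mpr he)
  have h2 := thetaOn_principal_mul e I (Finsupp.single t 1)
  rw [h1, one_mul, chainMap_single] at h2
  rw [SetLike.mem_coe, LinearMap.mem_ker, map_sub, map_smul, sub_eq_zero]
  exact h2.symm

lemma range_chainD_le_ker_thetaOn (I : idealsPrimeTo T) :
    LinearMap.range (chainD (BarClass S T V W) (Module.finrank ℚ F - 1 + 1)) ≤
      LinearMap.ker (thetaOn S T V W I) := by
  rw [← ker_chainD]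
  intro c hc
  have h : Submodule.mkQ (LinearMap.ker (chainD (BarClass S T V W) (Module.finrank ℚ F - 1))) c
      = 0 := (Submodule.Quotient.mk_eq_zero _).mpr hc
  rw [LinearMap.mem_ker, thetaOn_apply, h, map_zero, TensorProduct.zero_tmul, map_zero]

lemma augSub_posUnits_le {U : Finset (InfinitePlace F)} {Y : Type*} [MulAction (posOn T U) Y] :
    augSub 1 (posUnitsHom T U).range Y ≤ augSub (sgnOn T U) (unitsOn T U) Y := by
  rw [augSub_congr 1 (χ' := sgnOn T U)]
  · exact augSub_mono _ range_posUnitsHom_le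
  · rintro _ ⟨e, rfl⟩
    exact (sgnOn_posUnitsHom e).symm

lemma trivialChains_le_ker_thetaOn (I : idealsPrimeTo T) :
    trivialChains T (bar S V W).toLeft _ ≤ LinearMap.ker (thetaOn S T V W I) :=
  sup_le (augSub_posUnits_le.trans (augSub_le_ker_thetaOn I)) (range_chainD_le_ker_thetaOn I)

lemma thetaOn_chainMap (h : posOn T (bar S V W).toLeft) (I : idealsPrimeTo T)
    {c : Chain (BarClass S T V W) (Module.finrank ℚ F - 1 + 1)} (hc : IsCycleOn c) :
    thetaOn S T V W I (chainMap (h • ·) _ c) = thetaOn S T V W I c := by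
  rw [← sub_eq_zero, ← map_sub]
  exact trivialChains_le_ker_thetaOn I (chainMap_smul_sub_mem 1 h hc)

/-- Multiplication of the ideal by an element that is positive on `W` multiplies the class attached
to a cycle by its sign. -/
lemma thetaOn_principal_mul_of_isCycleOn (h : posOn T (bar S V W).toLeft) (I : idealsPrimeTo T)
    {c : Chain (BarClass S T V W) (Module.finrank ℚ F - 1 + 1)} (hc : IsCycleOn c) :
    thetaOn S T V W (principalPrimeTo T h.1 * I) c =
      ((sgnOn T _ h : ℤˣ) : ℤ) • thetaOn S T V W I c := by
  rw [thetaOn_principal_mul, thetaOn_chainMap h I hc]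

/-- The class attached to a cycle depends only on its homology class and on the narrow class of the
ideal. -/
lemma thetaOn_eq_of_mk_eq {I I' : idealsPrimeTo T}
    (hI : (QuotientGroup.mk I.1 : NarrowClassGroup F) = QuotientGroup.mk I'.1)
    {c c' : Chain (BarClass S T V W) (Module.finrank ℚ F - 1 + 1)} (hc : IsCycleOn c')
    (hcc' : c - c' ∈ trivialChains T (bar S V W).toLeft _) :
    thetaOn S T V W I c = thetaOn S T V W I' c' := by
  have h1 : thetaOn S T V W I c = thetaOn S T V W I c' := by
    rw [← sub_eq_zero, ← map_sub]
    exact trivialChains_le_ker_thetaOn I hcc'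
  rw [h1]
  obtain ⟨x, hx, hxI⟩ := QuotientGroup.eq.mp hI.symm
  have hxT : x ∈ unitsPrimeTo T := by
    change principal F x ∈ idealsPrimeTo T
    rw [hxI]
    exact mul_mem (inv_mem I'.2) I.2
  let h : posOn T (bar S V W).toLeft :=
    ⟨⟨x, hxT⟩, signs_eq_one_iff.mpr fun w _ => mem_totallyPositive_iff.mp hx w⟩
  have hII' : I = principalPrimeTo T h.1 * I' := by
    refine Subtype.ext ?_
    change I.1 = principal F x * I'.1
    rw [hxI, mul_comm, mul_inv_cancel_left]
  have hs : sgnOn T _ h = 1 := sgn_eq_one_of_totallyPositive hx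
  rw [hII', thetaOn_principal_mul_of_isCycleOn h I' hc, hs, Units.val_one, one_smul]

end Theta

/-! ### Restriction of `ϑ` -/

section Restriction

variable {F : Type*} [Field F] [NumberField F] [IsTotallyReal F] {S T V W : Finset (Place F)}

lemma resK_bracket {U U' : Finset (InfinitePlace F)} (h : U' ⊆ U)
    (D : ConeMod F (SignClass T (1 : SignGroup U))) :
    resK T h (bracket T 1 D) = bracket T 1 (chainModMap (SignClass.res h) _ D) := by
  obtain ⟨d, rfl⟩ := Submodule.mkQ_surjective _ D
  change KMod.mk T U' (Finsupp.mapDomain _ (Finsupp.mapDomain _ d)) =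
    KMod.mk T U' (Finsupp.mapDomain _ (Finsupp.mapDomain _ d))
  rw [← Finsupp.mapDomain_comp, ← Finsupp.mapDomain_comp]
  rfl

/-- The restriction of a term of `ϑ`. The element `A` is `𝔞⁻¹ δ_{S,T}`, regarded as an element of the
larger module `𝒜_{W̄ ∩ S_f}`. -/
lemma mk_resB_thetaTerm (hVS : V ⊆ S) (hC1 : ConditionC1 S T V) (hW : W ⊆ V)
    (D : ConeMod F (PosClass S T V)) (I : idealsPrimeTo T) {A : AMod T (bar S V W).toRight}
    (hA : (A : MonoidAlgebra ℤ (FracIdeals F)) =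
      MonoidAlgebra.single (I⁻¹).1 (1 : ℤ) * delta T (bar S V V).toRight)
    {c : Chain (BarClass S T V W) (Module.finrank ℚ F - 1 + 1)}
    (hc : Submodule.mkQ _ c =
      chainModMap (SignClass.res (Finset.toLeft_subset_toLeft (bar_mono S V hW))) _ D) :
    Representation.Coinvariants.mk (repB S T V W)
        (resB hVS hC1 (Finset.Subset.refl V) hW (thetaTerm S T V D I)) =
      tensorClass S T V W (iota S I.1) (bracket T 1 (Submodule.mkQ _ c) ⊗ₜ[ℤ] A) := by
  have hle : AMod T (bar S V V).toRight ≤ AMod T (bar S V W).toRight :=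
    AMod_le (Finset.toRight_subset_toRight (bar_mono S V hW)) fun p hp =>
      hC1.residueChar_S_T p (Finset.toRight_subset_toRight
        (Finset.union_subset hVS Finset.sdiff_subset) hp)
  have hA' : A = Submodule.inclusion hle (deltaElt S T V V I) := Subtype.ext hA
  rw [hc, ← resK_bracket, hA']
  rfl

lemma tensorClass_tmul_sub (s : NS S) (m : KMod T (bar S V W).toLeft)
    (A A' : AMod T (bar S V W).toRight) :
    tensorClass S T V W s (m ⊗ₜ[ℤ] (A - A')) =
      tensorClass S T V W s (m ⊗ₜ[ℤ] A) - tensorClass S T V W s (m ⊗ₜ[ℤ] A') := by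
  rw [TensorProduct.tmul_sub, map_sub]

lemma iota_primeIdeal {p : HeightOneSpectrum (𝓞 F)} (hp : Sum.inr p ∈ S) :
    iota S (primeIdeal p) = 1 := by
  refine RestrictedProduct.ext _ _ fun v => ?_
  change toLocal v.1 (uniformizer v.1) ^ FractionalIdeal.count F v.1 _ = 1
  have h : FractionalIdeal.count F v.1 (primeIdeal p : FractionalIdeal (𝓞 F)⁰ F) = 0 := by
    refine FractionalIdeal.count_maximal_coprime F v.1 ?_
    rintro rfl
    exact v.2 hp
  rw [h, zpow_zero]

lemma mem_bar_erase_iff {v : Place F} (hv : v ∈ V) {w : Place F} (hw : w ∈ S ∪ V) :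
    w ∈ bar S V (V.erase v) ↔ w ≠ v := by
  rw [bar, Finset.mem_union, Finset.mem_erase, Finset.mem_sdiff]
  rw [Finset.mem_union] at hw
  by_cases h : w = v
  · subst h
    simp [hv]
  · by_cases h' : w ∈ V
    · simp [h, h']
    · simpa [h, h'] using hw

lemma sgn_eq_neg_one {v : InfinitePlace F} {x : Fˣ} (hv : signAt v x = -1)
    (h : ∀ w ≠ v, signAt w x = 1) : sgn x = -1 := by
  rw [sgn_apply, Finset.prod_eq_single v (fun w _ hw => h w hw)
    (fun h => absurd (Finset.mem_univ v) h), hv]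

end Restriction

/-! ### Vanishing of the sum at an infinite place -/

section Cancellation

variable {F : Type*} [Field F] [NumberField F] [IsTotallyReal F] {S T V W : Finset (Place F)}

lemma sum_eq_zero_of_mul_eq_neg {Γ M : Type*} [Group Γ] [Fintype Γ] [AddCommGroup M] {f : Γ → M}
    {g : Γ} (hg1 : g ≠ 1) (hgg : g * g = 1) (hneg : ∀ C, f (g * C) = -f C) : ∑ C, f C = 0 := by
  refine Finset.sum_involution (fun C _ => g * C) (fun C _ => ?_) (fun C _ _ hC => ?_)
    (fun _ _ => Finset.mem_univ _) (fun C _ => ?_)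
  · rw [hneg, add_neg_cancel]
  · exact hg1 (mul_eq_right.mp hC)
  · rw [← mul_assoc, hgg, one_mul]

lemma sum_sub_mul_left_eq_zero {Γ M : Type*} [Group Γ] [Fintype Γ] [AddCommGroup M] (f : Γ → M)
    (g : Γ) : ∑ C, (f C - f (g * C)) = 0 := by
  rw [Finset.sum_sub_distrib, sub_eq_zero]
  exact (Equiv.sum_comp (Equiv.mulLeft g) f).symm

/-- If some unit is positive on `W̄` and has norm sign `-1`, then a cycle is killed by `2` in the
twisted homology of the units that are positive on `W̄`; since this homology has no `2`-torsion, the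
class attached to the cycle vanishes. -/
lemma thetaOn_eq_zero_of_unit (hW : (bar S V W).toLeft.Nonempty)
    {ε : posOn T (bar S V W).toLeft} (hε : ε ∈ unitsOn T _) (hεs : sgnOn T _ ε = -1)
    (I : idealsPrimeTo T) {c : Chain (BarClass S T V W) (Module.finrank ℚ F - 1 + 1)}
    (hc : IsCycleOn c) : thetaOn S T V W I c = 0 := by
  have := free_unitsOn (T := T) hW
  have := finite_unitsOn (T := T) hW
  refine (sup_le (augSub_le_ker_thetaOn I) (range_chainD_le_ker_thetaOn I))
    (mem_of_two_smul_mem posOn_free (sgnOn T _) (unitsOn T _) (finrank_unitsOn_le hW) ?_)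
  have h1 := twisted_sub_mem_augSub (sgnOn T _) hε c
  rw [hεs, Units.val_neg, Units.val_one, neg_one_smul] at h1
  have h2 := sup_le_sup_right (augSub_posUnits_le (T := T) (U := (bar S V W).toLeft)) _
    (chainMap_smul_sub_mem 1 ε hc)
  have h3 : (2 : ℤ) • c = -((-Finsupp.mapDomain (ε • ·) c - c) +
      (chainMap (ε • · : BarClass S T V W → _) _ c - c)) := by
    change _ = -((-Finsupp.mapDomain (ε • ·) c - c) + (Finsupp.mapDomain (ε • ·) c - c))
    rw [two_smul]
    abel
  rw [h3]
  exact neg_mem (add_mem (Submodule.mem_sup_left h1) h2)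

/-- A family of ideals prime to `T`, representing the narrow classes, and of cycles that are pairwise
homologous. -/
structure ThetaFamily (S T V W : Finset (Place F)) where
  /-- The ideal in each class. -/
  I : NarrowClassGroup F → idealsPrimeTo T
  /-- The cycle attached to each class. -/
  c : NarrowClassGroup F → Chain (BarClass S T V W) (Module.finrank ℚ F - 1 + 1)
  mk_I : ∀ C, (QuotientGroup.mk (I C).1 : NarrowClassGroup F) = C
  isCycleOn_c : ∀ C, IsCycleOn (c C)
  sub_mem : ∀ C C', c C - c C' ∈ trivialChains T (bar S V W).toLeft _

namespace ThetaFamily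

variable (f : ThetaFamily S T V W)

/-- The term of the sum at the class `C`. -/
def term (C : NarrowClassGroup F) : (repB S T V W).Coinvariants := thetaOn S T V W (f.I C) (f.c C)

lemma thetaOn_mul (J : idealsPrimeTo T) (C : NarrowClassGroup F) :
    thetaOn S T V W (J * f.I C) (f.c C) = f.term (QuotientGroup.mk J.1 * C) := by
  refine thetaOn_eq_of_mk_eq ?_ (f.isCycleOn_c _) (f.sub_mem _ _)
  rw [f.mk_I, Subgroup.coe_mul, QuotientGroup.mk_mul, f.mk_I]

/-- The sum over the narrow classes vanishes if there is an element that is positive on `W̄` and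
negative at an odd number of the other infinite places: multiplication by its class changes the sign
of the terms. -/
lemma sum_term_eq_zero [Fintype (NarrowClassGroup F)] (hW : (bar S V W).toLeft.Nonempty)
    (h : posOn T (bar S V W).toLeft) (hs : sgnOn T _ h = -1) : ∑ C, f.term C = 0 := by
  set g : NarrowClassGroup F := QuotientGroup.mk (principal F h.1.1) with hg
  have hneg : ∀ C, f.term (g * C) = -f.term C := fun C => by
    have h1 := thetaOn_principal_mul_of_isCycleOn h (f.I C) (f.isCycleOn_c C)
    rw [f.thetaOn_mul, hs, Units.val_neg, Units.val_one] at h1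
    exact h1.trans (neg_one_zsmul _)
  by_cases hg1 : g = 1
  -- The ideal `(h)` has a totally positive generator `y`, and `h / y` is a unit of sign `-1`.
  · obtain ⟨y, hy, hyx⟩ := (QuotientGroup.eq_one_iff _).mp hg1
    have hyT : y ∈ unitsPrimeTo T := by
      change principal F y ∈ idealsPrimeTo T
      rw [hyx]
      exact h.1.2
    let y' : posOn T (bar S V W).toLeft :=
      ⟨⟨y, hyT⟩, signs_eq_one_iff.mpr fun w _ => mem_totallyPositive_iff.mp hy w⟩
    have hy's : sgnOn T _ y' = 1 := sgn_eq_one_of_totallyPositive hy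
    have hε : h * y'⁻¹ ∈ unitsOn T _ := by
      refine principal_eq_one_iff.mp ?_
      change principal F (h.1.1 * y⁻¹) = 1
      rw [map_mul, map_inv, hyx, mul_inv_cancel]
    refine Finset.sum_eq_zero fun C _ => thetaOn_eq_zero_of_unit hW hε ?_ _ (f.isCycleOn_c C)
    rw [map_mul, map_inv, hy's, hs, inv_one, mul_one]
  · have hgg : g * g = 1 := by
      rw [hg, ← QuotientGroup.mk_mul, ← map_mul, QuotientGroup.eq_one_iff]
      refine Subgroup.mem_map_of_mem _ (mem_totallyPositive_iff.mpr fun w => ?_)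
      rw [map_mul, Int.units_mul_self]
    exact sum_eq_zero_of_mul_eq_neg hg1 hgg hneg

end ThetaFamily

end Cancellation

end

end Shintani

/-! ### The restrictions of `ϑ` vanish in the coinvariants -/

open Shintani in
theorem mainTheorem6 (F : Type*) [Field F] [NumberField F] [NumberField.IsTotallyReal F]
    (S T V : Finset (Shintani.Place F))
    (hS : ∀ w : NumberField.InfinitePlace F, Sum.inl w ∈ S) (hST : Disjoint S T) (hVS : V ⊂ S)
    (hC1 : Shintani.ConditionC1 S T V)
    (η : Shintani.HomologyOf (Shintani.posUnits F)) (hη : AddSubgroup.zmultiples η = ⊤)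
    (ϑ : (Shintani.repB S T V V).Coinvariants) (hϑ : Shintani.IsTheta S T V η ϑ)
    (a : Shintani.B S T V V)
    (ha : Representation.Coinvariants.mk (Shintani.repB S T V V) a = ϑ)
    (v : Shintani.Place F) (hv : v ∈ V) :
    Shintani.resB hVS.subset hC1 (Finset.Subset.refl V) (Finset.erase_subset v V) a ∈
      Representation.Coinvariants.ker (Shintani.repB S T V (V.erase v)) := by
  have := Fintype.ofFinite (NarrowClassGroup F)
  obtain ⟨D, I, hD, hI, rfl⟩ := hϑ
  set W := V.erase v
  have hWV : W ⊆ V := Finset.erase_subset v V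
  have hU := Finset.toLeft_subset_toLeft (bar_mono S V hWV)
  have hmem : ∀ w, w ∈ S → (w ∈ bar S V W ↔ w ≠ v) := fun w hw =>
    mem_bar_erase_iff hv (Finset.mem_union_left _ hw)
  choose c hc using fun C => Submodule.mkQ_surjective _
    (chainModMap (SignClass.res (T := T) hU) _ (D C))
  let f : ThetaFamily S T V W := ⟨I, c, hI, fun C => isCycleOn_of_mem hU (hD C) (hc C),
    fun C C' => sub_mem_trivialChains hU (hD C) (hD C') (hc C) (hc C')⟩
  have hker : Representation.Coinvariants.ker (repB S T V V) ≤
      (Representation.Coinvariants.ker (repB S T V W)).comap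
        (resB hVS.subset hC1 (Finset.Subset.refl V) hWV) := by
    refine Submodule.span_le.mpr ?_
    rintro _ ⟨⟨x, b⟩, rfl⟩
    rw [SetLike.mem_coe, Submodule.mem_comap, map_sub, resB_repB]
    exact Representation.Coinvariants.sub_mem_ker x _
  rw [finsum_eq_sum_of_fintype, ← map_sum, Representation.Coinvariants.mk_eq_iff] at ha
  have h1 := hker ha
  rw [Submodule.mem_comap, map_sub] at h1
  refine (Submodule.sub_mem_iff_left _ ?_).mp h1
  rw [← Representation.Coinvariants.mk_eq_zero, map_sum, map_sum]
  obtain v | p := v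
  · have hright : (bar S V V).toRight = (bar S V W).toRight := by
      ext q
      have hq : q ∈ (bar S V V).toRight ↔ Sum.inr q ∈ S := by
        rw [Finset.mem_toRight, bar, Finset.union_sdiff_of_subset hVS.subset]
      rw [hq, Finset.mem_toRight]
      constructor
      · exact fun h => (hmem _ h).mpr (by simp)
      · exact fun h => Finset.union_subset (hWV.trans hVS.subset) Finset.sdiff_subset h
    have hterm : ∀ C, Representation.Coinvariants.mk _ (resB hVS.subset hC1
        (Finset.Subset.refl V) hWV (thetaTerm S T V (D C) (I C))) = f.term C := fun C =>
      mk_resB_thetaTerm hVS.subset hC1 hWV (D C) (I C) (A := deltaElt S T V W (I C))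
        (by rw [hright]; rfl) (hc C)
    rw [Finset.sum_congr rfl fun C _ => hterm C]
    obtain ⟨w, hw⟩ := hC1.not_infinite_subset
    obtain ⟨x, hxT, hxv, hx⟩ := exists_signAt_eq_neg_one T v
    refine f.sum_term_eq_zero ⟨w, Finset.mem_toLeft.mpr ((hmem _ (hS w)).mpr ?_)⟩
      ⟨⟨x, hxT⟩, signs_eq_one_iff.mpr fun w hw => hx w ?_⟩ (sgn_eq_neg_one hxv hx)
    · rintro h
      exact hw (h ▸ hv)
    · rintro rfl
      exact (hmem _ (hS w)).mp (Finset.mem_toLeft.mp hw) rfl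
  · have hpS : Sum.inr p ∈ S := hVS.subset hv
    let P : idealsPrimeTo T := ⟨primeIdeal p, primeIdeal_mem_idealsPrimeTo fun q hq =>
      hC1.residueChar_S_T p (Finset.mem_toRight.mpr hpS) q hq⟩
    have hdelta : delta T (bar S V V).toRight =
        (1 - MonoidAlgebra.single (primeIdeal p) 1) * delta T (bar S V W).toRight := by
      have hins : (bar S V V).toRight = Finset.cons p (bar S V W).toRight
          (fun h => (hmem _ hpS).mp (Finset.mem_toRight.mp h) rfl) := by
        ext q
        rw [Finset.mem_cons, Finset.mem_toRight, bar, Finset.union_sdiff_of_subset hVS.subset,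
          Finset.mem_toRight]
        constructor
        · intro h
          by_cases hqp : q = p
          · exact Or.inl hqp
          · exact Or.inr ((hmem _ h).mpr fun h' => hqp (Sum.inr_injective h'))
        · rintro (rfl | h)
          · exact hpS
          · exact Finset.union_subset (hWV.trans hVS.subset) Finset.sdiff_subset h
      rw [delta, delta, hins, Finset.prod_cons, mul_assoc]
    -- The two terms come from `δ_V = (1 - [p]) δ_W`; in the second one `ι(𝔞) = ι(p⁻¹ 𝔞)`.
    have hterm : ∀ C, Representation.Coinvariants.mk _ (resB hVS.subset hC1
        (Finset.Subset.refl V) hWV (thetaTerm S T V (D C) (I C))) =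
          f.term C - f.term (QuotientGroup.mk (P⁻¹).1 * C) := fun C => by
      rw [mk_resB_thetaTerm hVS.subset hC1 hWV (D C) (I C)
        (A := deltaElt S T V W (I C) - deltaElt S T V W (P⁻¹ * I C)) ?_ (hc C),
        tensorClass_tmul_sub, ← f.thetaOn_mul]
      · have hi : iota S (I C).1 = iota S (P⁻¹ * I C).1 := by
          rw [Subgroup.coe_mul, map_mul, Subgroup.coe_inv, map_inv, iota_primeIdeal hpS, inv_one,
            one_mul]
        congr 1
        rw [hi]
        rfl
      · rw [hdelta, ← mul_assoc, mul_sub, mul_one, MonoidAlgebra.single_mul_single, mul_one,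
          sub_mul]
        change MonoidAlgebra.single _ 1 * _ - MonoidAlgebra.single ((P⁻¹ * I C)⁻¹).1 1 * _ = _
        rw [mul_inv_rev, inv_inv]
        rfl
    rw [Finset.sum_congr rfl fun C _ => hterm C]
    exact sum_sub_mul_left_eq_zero f.term _
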